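/- Let $\mathcal{A}$ be the unital $\mathbb{C}$-algebra generated by $a,b$ with $ab-ba=b^2$, graded by $\deg a=\deg b=1$, and let $\tilde{\mathcal{A}}=\{\sum_{\nu\ge 0}P_\nu(a)\,b^\nu : P_\nu\in\mathbb{C}[z]\}$ be its $b$-completion, so that $aS(b)-S(b)a=b^2S'(b)$ for $S\in\mathbb{C}[[b]]$. The initial form of a non-zero element of $\tilde{\mathcal{A}}$ is its non-zero homogeneous component of smallest degree; a homogeneous element of degree $d$ is monic in $a$ if its coefficient on $a^d$ is $1$. An (a,b)-module is a left $\tilde{\mathcal{A}}$-module $F$ that is free of finite rank over $\mathbb{C}[[b]]$. Let $F^\sharp$ be its saturation, i.e. the smallest $\mathbb{C}[[b]]$-submodule of $F[b^{-1}]$ containing $F$ and stable by $b^{-1}a$. $F$ is regular if $F^\sharp$ is of finite type over $\mathbb{C}[[b]]$, and its Bernstein polynomial $B_F\in\mathbb{C}[x]$ is then the minimal polynomial of $-b^{-1}a$ acting on $F^\sharp/bF^\sharp$. A fresco is a regular (a,b)-module such that all the roots of $B_F$ are negative rational numbers and that is generated by one element as a left $\tilde{\mathcal{A}}$-module. The Bernstein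 element of a fresco $F$ of rank $k$ is $P_F:=(-b)^k B_F(-b^{-1}a)$, computed in $\mathcal{A}[b^{-1}]$. **Lemma.** Let $F$ be a fresco of rank $k$ and let $e$ be a generator of $F$ as a left $\tilde{\mathcal{A}}$-module. Let $\mathcal{Q}\in\tilde{\mathcal{A}}$ satisfy $\mathcal{Q}e=0$, and assume that the initial form $Q$ of $\mathcal{Q}$, homogeneous of degree $q$ in $(a,b)$, is monic in $a$. Then: 1. $P_F$ is an element of $\mathcal{A}$, homogeneous of degree $k$ and monic in $a$. If $F\simeq\tilde{\mathcal{A}}/\tilde{\mathcal{A}}\Pi$ with $\Pi=(a-\lambda_1b)S_1^{-1}\cdots(a-\lambda_kb)S_k^{-1}$, where $\lambda_j\in\mathbb{C}$, $S_j\in\mathbb{C}[[b]]$ and $S_j(0)=1$, then $P_F=(a-\lambda_1b)\cdots(a-\lambda_kb)$. 2. $q\ge k$, and there is a homogeneous element $W\in\mathcal{A}$ of degree $q-k$, monic in $a$, such that $Q=W\,P_F$. 3. There are unique polynomials $B_Q,C\in\mathbb{C}[x]$ such that, in $\mathcal{A}[b^{-1}]$, $$B_Q(-b^{-1}a)=(-b)^{-q}\,Q,\qquad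 C(-b^{-1}a)=(-b)^{-k}\big[(-b)^{-(q-k)}\,W\big](-b)^{k},$$ and $B_Q=C\cdot B_F$ in $\mathbb{C}[x]$. In particular $B_F$ divides $B_Q$. -/

import Mathlib

open Polynomial

/-- The algebra `Ã`: an element is a series `∑ P_ν(a) b^ν` with arbitrary polynomials `P_ν ∈ ℂ[X]`.
It is recorded by the sequence `(P_ν)`, as a power series in `b` with coefficients in `ℂ[X]`. -/
@[ext] structure ABTilde : Type where
  /-- The series `∑ P_ν b^ν`. -/
  series : PowerSeries ℂ[X]

namespace ABTilde

lemma coeff_smul' (c : ℂ) (f : PowerSeries ℂ[X]) (n : ℕ) :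
    PowerSeries.coeff n (c • f) = c • PowerSeries.coeff n f := rfl

/-- `∑ P_ν b^ν ↦ ∑ P_ν' b^ν`. -/
noncomputable def dA : PowerSeries ℂ[X] →ₗ[ℂ] PowerSeries ℂ[X] where
  toFun f := PowerSeries.mk fun n => derivative (PowerSeries.coeff n f)
  map_add' f g := by ext1 n; simp
  map_smul' c f := by ext1 n; simp

/-- The derivation `-b² d/db`. -/
noncomputable def dB : PowerSeries ℂ[X] →ₗ[ℂ] PowerSeries ℂ[X] where
  toFun f := -(PowerSeries.X ^ 2 * PowerSeries.derivative ℂ[X] f)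
  map_add' f g := by simp [mul_add]; ring
  map_smul' c f := by
    ext1 n
    simp only [RingHom.id_apply, coeff_smul', map_neg, PowerSeries.coeff_X_pow_mul',
      PowerSeries.coeff_derivative]
    split_ifs <;> simp

lemma dA_mul (f g : PowerSeries ℂ[X]) : dA (f * g) = dA f * g + f * dA g := by
  ext1 n
  simp only [dA, LinearMap.coe_mk, AddHom.coe_mk, PowerSeries.coeff_mk, map_add,
    PowerSeries.coeff_mul, derivative_sum, derivative_mul, Finset.sum_add_distrib]

lemma dB_mul (f g : PowerSeries ℂ[X]) : dB (f * g) = dB f * g + f * dB g := by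
  simp only [dB, LinearMap.coe_mk, AddHom.coe_mk, Derivation.leibniz, smul_eq_mul]
  ring

lemma dA_dB (f : PowerSeries ℂ[X]) : dA (dB f) = dB (dA f) := by
  ext1 n
  simp only [dA, dB, LinearMap.coe_mk, AddHom.coe_mk, PowerSeries.coeff_mk, map_neg,
    PowerSeries.coeff_X_pow_mul', PowerSeries.coeff_derivative]
  split_ifs <;> simp

lemma X_pow_dvd_dA {n : ℕ} {f : PowerSeries ℂ[X]} (h : PowerSeries.X ^ n ∣ f) :
    PowerSeries.X ^ n ∣ dA f := by
  rw [PowerSeries.X_pow_dvd_iff] at h ⊢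
  intro m hm
  simp [dA, h m hm]

lemma X_pow_dvd_dB {n : ℕ} {f : PowerSeries ℂ[X]} (h : PowerSeries.X ^ n ∣ f) :
    PowerSeries.X ^ (n + 1) ∣ dB f := by
  rw [PowerSeries.X_pow_dvd_iff] at h ⊢
  intro m hm
  simp only [dB, LinearMap.coe_mk, AddHom.coe_mk, map_neg, PowerSeries.coeff_X_pow_mul',
    PowerSeries.coeff_derivative]
  split_ifs with h2
  · rw [h _ (by omega)]; simp
  · simp

lemma X_pow_dvd_dA_pow {n : ℕ} {f : PowerSeries ℂ[X]} (h : PowerSeries.X ^ n ∣ f) (j : ℕ) :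
    PowerSeries.X ^ n ∣ (dA ^ j) f := by
  induction j with
  | zero => simpa using h
  | succ j ih => rw [pow_succ', Module.End.mul_apply]; exact X_pow_dvd_dA ih

lemma X_pow_dvd_dB_pow {n : ℕ} {f : PowerSeries ℂ[X]} (h : PowerSeries.X ^ n ∣ f) (j : ℕ) :
    PowerSeries.X ^ (j + n) ∣ (dB ^ j) f := by
  induction j with
  | zero => simpa using h
  | succ j ih =>
    rw [pow_succ', Module.End.mul_apply, show j + 1 + n = (j + n) + 1 by ring]
    exact X_pow_dvd_dB ih

/-- Leibniz rule for iterates of a derivation, with divided powers. -/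
lemma divPow_mul {A : Type*} [CommRing A] [Algebra ℂ A] (D : A →ₗ[ℂ] A)
    (hD : ∀ f g, D (f * g) = D f * g + f * D g) (n : ℕ) (f g : A) :
    ((n.factorial : ℂ)⁻¹) • (D ^ n) (f * g) = ∑ p ∈ Finset.HasAntidiagonal.antidiagonal n,
      (((p.1.factorial : ℂ)⁻¹ • (D ^ p.1) f) * ((p.2.factorial : ℂ)⁻¹ • (D ^ p.2) g)) := by
  have key : ∀ n : ℕ, (D ^ n) (f * g) = ∑ p ∈ Finset.HasAntidiagonal.antidiagonal n,
      (n.choose p.1 : ℂ) • ((D ^ p.1) f * (D ^ p.2) g) := by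
    intro n
    induction n with
    | zero => simp
    | succ n ih =>
      rw [pow_succ', Module.End.mul_apply, ih, map_sum]
      simp only [map_smul, hD, smul_add, Finset.sum_add_distrib]
      have h1 := Finset.sum_antidiagonal_choose_succ_nsmul
        (fun i j => (D ^ i) f * (D ^ j) g) n
      simp only [← Nat.cast_smul_eq_nsmul ℂ] at h1
      rw [h1, add_comm]
      congr 1
      · refine Finset.sum_congr rfl fun p _ => ?_
        rw [pow_succ' D p.2, Module.End.mul_apply]
      · refine Finset.sum_congr rfl fun p hp => ?_
        rw [pow_succ' D p.1, Module.End.mul_apply]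
        rw [← Finset.HasAntidiagonal.mem_antidiagonal.mp hp, Nat.choose_symm_add]
  rw [key, Finset.smul_sum]
  refine Finset.sum_congr rfl fun p hp => ?_
  rw [smul_smul, smul_mul_smul_comm]
  congr 1
  have := Finset.HasAntidiagonal.mem_antidiagonal.mp hp
  subst this
  have h := Nat.add_choose_mul_factorial_mul_factorial p.1 p.2
  rw [← Nat.choose_symm_add] at h
  have h' : ((p.1 + p.2).choose p.1 : ℂ) * p.1.factorial * p.2.factorial
      = (p.1 + p.2).factorial := by exact_mod_cast h
  have e1 : (p.1.factorial : ℂ) ≠ 0 := by exact_mod_cast p.1.factorial_ne_zero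
  have e2 : (p.2.factorial : ℂ) ≠ 0 := by exact_mod_cast p.2.factorial_ne_zero
  rw [← h'] 
  have e3 : ((p.1 + p.2).choose p.1 : ℂ) ≠ 0 := by
    exact_mod_cast (Nat.choose_pos (Nat.le_add_right _ _)).ne'
  field_simp

/-- The `j`-th term `(1/j!) (-b²d/db)^j f · (d/da)^j g` of the reordered product of `f` and `g`. -/
noncomputable def term (j : ℕ) (f g : PowerSeries ℂ[X]) : PowerSeries ℂ[X] :=
  (j.factorial : ℂ)⁻¹ • ((dB ^ j) f * (dA ^ j) g)

lemma term_add_left (j : ℕ) (f f' g : PowerSeries ℂ[X]) :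
    term j (f + f') g = term j f g + term j f' g := by
  simp [term, add_mul]
lemma term_add_right (j : ℕ) (f g g' : PowerSeries ℂ[X]) :
    term j f (g + g') = term j f g + term j f g' := by
  simp [term, mul_add]
lemma term_sum_left {ι : Type*} (s : Finset ι) (j : ℕ) (f : ι → PowerSeries ℂ[X])
    (g : PowerSeries ℂ[X]) : term j (∑ i ∈ s, f i) g = ∑ i ∈ s, term j (f i) g := by
  simp [term, Finset.sum_mul, Finset.smul_sum]
lemma term_sum_right {ι : Type*} (s : Finset ι) (j : ℕ) (f : PowerSeries ℂ[X])
    (g : ι → PowerSeries ℂ[X]) : term j f (∑ i ∈ s, g i) = ∑ i ∈ s, term j f (g i) := by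
  simp [term, Finset.mul_sum, Finset.smul_sum]
lemma term_sub_left (j : ℕ) (f f' g : PowerSeries ℂ[X]) :
    term j (f - f') g = term j f g - term j f' g := by
  simp [term, sub_mul, smul_sub]
lemma term_sub_right (j : ℕ) (f g g' : PowerSeries ℂ[X]) :
    term j f (g - g') = term j f g - term j f g' := by
  simp [term, mul_sub, smul_sub]

lemma dvd_smul_C {n : ℕ} {f : PowerSeries ℂ[X]} (c : ℂ) (h : PowerSeries.X ^ n ∣ f) :
    PowerSeries.X ^ n ∣ c • f := by
  rw [PowerSeries.X_pow_dvd_iff] at h ⊢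
  intro m hm
  simp [h m hm]

lemma dvd_term_left {n : ℕ} {f : PowerSeries ℂ[X]} (h : PowerSeries.X ^ n ∣ f) (j : ℕ)
    (g : PowerSeries ℂ[X]) : PowerSeries.X ^ (j + n) ∣ term j f g :=
  dvd_smul_C _ (Dvd.dvd.mul_right (X_pow_dvd_dB_pow h j) _)

lemma dvd_term_right {n : ℕ} {g : PowerSeries ℂ[X]} (h : PowerSeries.X ^ n ∣ g) (j : ℕ)
    (f : PowerSeries ℂ[X]) : PowerSeries.X ^ (j + n) ∣ term j f g := by
  refine dvd_smul_C _ ?_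
  rw [pow_add]
  exact mul_dvd_mul (by simpa using X_pow_dvd_dB_pow (n := 0) (f := f) (by simp) j)
    (X_pow_dvd_dA_pow h j)

/-- Associativity, order by order, of the product `∑ (1/j!) E^j f · D^j g` for commuting
derivations `D` and `E` of a commutative algebra. -/
lemma sum_term_assoc {A : Type*} [CommRing A] [Algebra ℂ A] (D E : A →ₗ[ℂ] A)
    (hD : ∀ f g, D (f * g) = D f * g + f * D g) (hE : ∀ f g, E (f * g) = E f * g + f * E g)
    (hDE : Commute D E) (T : ℕ → A → A → A)
    (hT : ∀ j f g, T j f g = (j.factorial : ℂ)⁻¹ • ((E ^ j) f * (D ^ j) g))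
    (n : ℕ) (f g h : A) :
    ∑ p ∈ Finset.HasAntidiagonal.antidiagonal n, T p.1 (T p.2 f g) h
      = ∑ p ∈ Finset.HasAntidiagonal.antidiagonal n, T p.1 f (T p.2 g h) := by
  let G : ℕ → ℕ → ℕ → A := fun j s t =>
    ((j.factorial : ℂ)⁻¹ * (s.factorial : ℂ)⁻¹ * (t.factorial : ℂ)⁻¹) •
      ((E ^ (s + j)) f * (E ^ t) ((D ^ j) g) * (D ^ (s + t)) h)
  have hl : ∀ p : ℕ × ℕ, T p.1 (T p.2 f g) h
      = ∑ q ∈ Finset.HasAntidiagonal.antidiagonal p.1, G p.2 q.1 q.2 := by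
    rintro ⟨m, j⟩
    have : T m (T j f g) h = (j.factorial : ℂ)⁻¹ •
        (((m.factorial : ℂ)⁻¹ • (E ^ m) ((E ^ j) f * (D ^ j) g)) * (D ^ m) h) := by
      simp only [hT, map_smul, smul_mul_assoc, smul_smul]
      rw [mul_comm]
    rw [this, divPow_mul E hE, Finset.sum_mul, Finset.smul_sum]
    refine Finset.sum_congr rfl fun q hq => ?_
    obtain rfl : q.1 + q.2 = m := Finset.HasAntidiagonal.mem_antidiagonal.mp hq
    simp only [G]
    rw [pow_add E, Module.End.mul_apply]
    simp only [smul_mul_assoc, mul_smul_comm, smul_smul]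
    congr 1; ring
  have hr : ∀ p : ℕ × ℕ, T p.1 f (T p.2 g h)
      = ∑ q ∈ Finset.HasAntidiagonal.antidiagonal p.1, G q.1 q.2 p.2 := by
    rintro ⟨m, j⟩
    have : T m f (T j g h) = (j.factorial : ℂ)⁻¹ • ((E ^ m) f *
        ((m.factorial : ℂ)⁻¹ • (D ^ m) ((E ^ j) g * (D ^ j) h))) := by
      simp only [hT, map_smul, mul_smul_comm, smul_smul]
      rw [mul_comm]
    rw [this, divPow_mul D hD, Finset.mul_sum, Finset.smul_sum]
    refine Finset.sum_congr rfl fun q hq => ?_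
    obtain rfl : q.1 + q.2 = m := Finset.HasAntidiagonal.mem_antidiagonal.mp hq
    have hc : (D ^ q.1) ((E ^ j) g) = (E ^ j) ((D ^ q.1) g) :=
      LinearMap.congr_fun (hDE.pow_pow q.1 j) g
    simp only [G]
    rw [hc, pow_add D q.2 j, Module.End.mul_apply, add_comm q.2 q.1]
    simp only [smul_mul_assoc, mul_smul_comm, smul_smul, mul_assoc]
    congr 1; ring
  simp only [hl, hr]
  rw [Finset.sum_sigma', Finset.sum_sigma']
  refine Finset.sum_nbij' (fun x => ⟨(x.1.2 + x.2.1, x.2.2), (x.1.2, x.2.1)⟩)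
    (fun x => ⟨(x.2.2 + x.1.2, x.2.1), (x.2.2, x.1.2)⟩) ?_ ?_ ?_ ?_ ?_ <;>
  · rintro ⟨⟨a, b⟩, ⟨c, d⟩⟩ hx
    simp only [Finset.mem_sigma, Finset.HasAntidiagonal.mem_antidiagonal] at hx
    obtain ⟨h1, h2⟩ := hx
    subst h2
    first
      | rfl
      | (simp only [Finset.mem_sigma, Finset.HasAntidiagonal.mem_antidiagonal, and_true]; omega)

lemma term_assoc (n : ℕ) (f g h : PowerSeries ℂ[X]) :
    ∑ p ∈ Finset.HasAntidiagonal.antidiagonal n, term p.1 (term p.2 f g) h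
      = ∑ p ∈ Finset.HasAntidiagonal.antidiagonal n, term p.1 f (term p.2 g h) :=
  sum_term_assoc dA dB dA_mul dB_mul (LinearMap.ext dA_dB) term (fun _ _ _ => rfl) n f g h

/-- The product of two normally ordered series. It is forced by `a b - b a = b²`: moving a series
`S(b)` past a polynomial `Q(a)` gives `S(b) Q(a) = ∑_j (1/j!) Q^(j)(a) · (-b² d/db)^j S(b)`. The sum
over `j` may be cut off at `n` in degree `n` in `b`, since `(-b² d/db)^j` raises the order in `b`
by `j`. -/
noncomputable def star (f g : PowerSeries ℂ[X]) : PowerSeries ℂ[X] :=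
  PowerSeries.mk fun n => ∑ j ∈ Finset.range (n + 1), PowerSeries.coeff n (term j f g)

lemma star_congr (n : ℕ) (f g : PowerSeries ℂ[X]) :
    PowerSeries.X ^ n ∣ star f g - ∑ j ∈ Finset.range n, term j f g := by
  rw [PowerSeries.X_pow_dvd_iff]
  intro m hm
  rw [map_sub, star, PowerSeries.coeff_mk, map_sum, sub_eq_zero]
  refine Finset.sum_subset (by simpa using hm) fun j _ hj => ?_
  have := dvd_term_left (n := 0) (f := f) (by simp) j g
  rw [PowerSeries.X_pow_dvd_iff] at this
  exact this m (by simpa using hj)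

lemma star_assoc (f g h : PowerSeries ℂ[X]) : star (star f g) h = star f (star g h) := by
  ext1 N
  have tri : ∀ (B : ℕ → ℕ → PowerSeries ℂ[X]),
      (∀ k j, PowerSeries.X ^ (k + j) ∣ B k j) →
      ∑ k ∈ Finset.range (N + 1), ∑ j ∈ Finset.range (N + 1), PowerSeries.coeff N (B k j)
        = ∑ n ∈ Finset.range (N + 1), ∑ p ∈ Finset.HasAntidiagonal.antidiagonal n,
            PowerSeries.coeff N (B p.1 p.2) := by
    intro B hB
    have hB' : ∀ k j, N < k + j → PowerSeries.coeff N (B k j) = 0 := fun k j hkj => by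
      have := hB k j
      rw [PowerSeries.X_pow_dvd_iff] at this
      exact this N hkj
    rw [← Finset.sum_product', Finset.sum_sigma']
    symm
    refine Finset.sum_bij_ne_zero (fun x _ _ => (x.2.1, x.2.2)) ?_ ?_ ?_ ?_
    · rintro ⟨n, p⟩ hx _
      simp only [Finset.mem_sigma, Finset.mem_range, Finset.HasAntidiagonal.mem_antidiagonal,
        Finset.mem_product] at hx ⊢
      omega
    · rintro ⟨n, p, q⟩ hx _ ⟨n', p', q'⟩ hx' _ he
      simp only [Finset.mem_sigma, Finset.mem_range, Finset.HasAntidiagonal.mem_antidiagonal] at hx hx'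
      simp only [Prod.mk.injEq] at he
      obtain ⟨rfl, rfl⟩ := he
      obtain ⟨_, rfl⟩ := hx
      obtain ⟨_, rfl⟩ := hx'
      rfl
    · rintro ⟨k, j⟩ _ hne
      refine ⟨⟨k + j, (k, j)⟩, ?_, hne, rfl⟩
      simp only [Finset.mem_sigma, Finset.mem_range, Finset.HasAntidiagonal.mem_antidiagonal, and_true]
      by_contra hc
      exact hne (hB' k j (by omega))
    · intros; rfl
  have coeff_eq : ∀ (x y : PowerSeries ℂ[X]), PowerSeries.X ^ (N + 1) ∣ x - y →
      PowerSeries.coeff N x = PowerSeries.coeff N y := by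
    intro x y hxy
    rw [PowerSeries.X_pow_dvd_iff] at hxy
    have := hxy N (by omega)
    rwa [map_sub, sub_eq_zero] at this
  have up : ∀ (k : ℕ) (x : PowerSeries ℂ[X]), PowerSeries.X ^ (k + (N + 1)) ∣ x →
      PowerSeries.X ^ (N + 1) ∣ x := fun k x hx => (pow_dvd_pow _ (by omega)).trans hx
  have L : PowerSeries.coeff N (star (star f g) h) = ∑ k ∈ Finset.range (N + 1),
      ∑ j ∈ Finset.range (N + 1), PowerSeries.coeff N (term k (term j f g) h) := by
    rw [star, PowerSeries.coeff_mk]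
    refine Finset.sum_congr rfl fun k _ => ?_
    rw [← map_sum, ← term_sum_left]
    refine coeff_eq _ _ ?_
    rw [← term_sub_left]
    exact up k _ (dvd_term_left (star_congr _ _ _) _ _)
  have R : PowerSeries.coeff N (star f (star g h)) = ∑ k ∈ Finset.range (N + 1),
      ∑ j ∈ Finset.range (N + 1), PowerSeries.coeff N (term k f (term j g h)) := by
    rw [star, PowerSeries.coeff_mk]
    refine Finset.sum_congr rfl fun k _ => ?_
    rw [← map_sum, ← term_sum_right]
    refine coeff_eq _ _ ?_
    rw [← term_sub_right]
    exact up k _ (dvd_term_right (star_congr _ _ _) _ _)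
  have d : ∀ (x y : PowerSeries ℂ[X]) (j : ℕ), PowerSeries.X ^ j ∣ term j x y := fun x y j => by
    simpa using dvd_term_left (n := 0) (f := x) (by simp) j y
  rw [L, R, tri _ fun k j => dvd_term_left (d f g j) k h,
    tri _ fun k j => dvd_term_right (d g h j) k f]
  refine Finset.sum_congr rfl fun n _ => ?_
  rw [← map_sum, ← map_sum, term_assoc]

lemma dA_one : dA 1 = 0 := by
  ext1 n; simp [dA, PowerSeries.coeff_one]; split_ifs <;> simp
lemma dB_one : dB 1 = 0 := by
  simp [dB]

lemma star_of_dB {f : PowerSeries ℂ[X]} (hf : dB f = 0) (g : PowerSeries ℂ[X]) :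
    star f g = f * g := by
  ext1 n
  rw [star, PowerSeries.coeff_mk, Finset.sum_eq_single 0]
  · simp [term]
  · intro j _ hj
    obtain ⟨j, rfl⟩ := Nat.exists_eq_succ_of_ne_zero hj
    simp [term, pow_succ, hf]
  · simp

lemma star_of_dA {g : PowerSeries ℂ[X]} (hg : dA g = 0) (f : PowerSeries ℂ[X]) :
    star f g = f * g := by
  ext1 n
  rw [star, PowerSeries.coeff_mk, Finset.sum_eq_single 0]
  · simp [term]
  · intro j _ hj
    obtain ⟨j, rfl⟩ := Nat.exists_eq_succ_of_ne_zero hj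
    simp [term, pow_succ, hg]
  · simp

lemma star_add (f g h : PowerSeries ℂ[X]) : star f (g + h) = star f g + star f h := by
  ext1 n
  simp only [star, PowerSeries.coeff_mk, map_add, term_add_right, Finset.sum_add_distrib]

lemma add_star (f g h : PowerSeries ℂ[X]) : star (f + g) h = star f h + star g h := by
  ext1 n
  simp only [star, PowerSeries.coeff_mk, map_add, term_add_left, Finset.sum_add_distrib]

lemma smul_star (c : ℂ) (f g : PowerSeries ℂ[X]) : star (c • f) g = c • star f g := by
  ext1 n
  simp only [star, PowerSeries.coeff_mk, coeff_smul', Finset.smul_sum]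
  refine Finset.sum_congr rfl fun j _ => ?_
  rw [← coeff_smul']
  congr 1
  simp only [term, map_smul, smul_mul_assoc, smul_comm c]

lemma star_smul (c : ℂ) (f g : PowerSeries ℂ[X]) : star f (c • g) = c • star f g := by
  ext1 n
  simp only [star, PowerSeries.coeff_mk, coeff_smul', Finset.smul_sum]
  refine Finset.sum_congr rfl fun j _ => ?_
  rw [← coeff_smul']
  congr 1
  simp only [term, map_smul, mul_smul_comm, smul_comm c]

lemma series_injective : Function.Injective series := fun _ _ => ABTilde.ext

noncomputable instance : Zero ABTilde := ⟨⟨0⟩⟩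
noncomputable instance : One ABTilde := ⟨⟨1⟩⟩
noncomputable instance : Add ABTilde := ⟨fun x y => ⟨x.series + y.series⟩⟩
noncomputable instance : Neg ABTilde := ⟨fun x => ⟨-x.series⟩⟩
noncomputable instance : Sub ABTilde := ⟨fun x y => ⟨x.series - y.series⟩⟩
noncomputable instance : Mul ABTilde := ⟨fun x y => ⟨star x.series y.series⟩⟩
noncomputable instance : SMul ℕ ABTilde := ⟨fun c x => ⟨c • x.series⟩⟩
noncomputable instance : SMul ℤ ABTilde := ⟨fun c x => ⟨c • x.series⟩⟩
noncomputable instance : SMul ℂ ABTilde := ⟨fun c x => ⟨c • x.series⟩⟩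

@[simp] lemma series_zero : (0 : ABTilde).series = 0 := rfl
@[simp] lemma series_one : (1 : ABTilde).series = 1 := rfl
@[simp] lemma series_add (x y : ABTilde) : (x + y).series = x.series + y.series := rfl
@[simp] lemma series_neg (x : ABTilde) : (-x).series = -x.series := rfl
@[simp] lemma series_sub (x y : ABTilde) : (x - y).series = x.series - y.series := rfl
@[simp] lemma series_smul (c : ℂ) (x : ABTilde) : (c • x).series = c • x.series := rfl
lemma series_mul (x y : ABTilde) : (x * y).series = star x.series y.series := rfl

noncomputable instance : AddCommGroup ABTilde :=
  series_injective.addCommGroup series rfl (fun _ _ => rfl) (fun _ => rfl) (fun _ _ => rfl)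
    (fun _ _ => rfl) (fun _ _ => rfl)

/-- `series` as an additive map. -/
noncomputable def seriesHom : ABTilde →+ PowerSeries ℂ[X] where
  toFun := series
  map_zero' := rfl
  map_add' _ _ := rfl

noncomputable instance : Module ℂ ABTilde :=
  series_injective.module ℂ seriesHom (fun _ _ => rfl)

noncomputable instance : Ring ABTilde where
  __ := (inferInstance : AddCommGroup ABTilde)
  left_distrib x y z := ABTilde.ext (star_add _ _ _)
  right_distrib x y z := ABTilde.ext (add_star _ _ _)
  zero_mul x := ABTilde.ext ((star_of_dB (map_zero dB) _).trans (zero_mul _))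
  mul_zero x := ABTilde.ext ((star_of_dA (map_zero dA) _).trans (mul_zero _))
  mul_assoc x y z := ABTilde.ext (star_assoc _ _ _)
  one_mul x := ABTilde.ext ((star_of_dB dB_one _).trans (one_mul _))
  mul_one x := ABTilde.ext ((star_of_dA dA_one _).trans (mul_one _))

noncomputable instance : Algebra ℂ ABTilde :=
  Algebra.ofModule (fun c x y => ABTilde.ext (smul_star c x.series y.series))
    (fun c x y => ABTilde.ext (star_smul c x.series y.series))

/-- The generator `a`. -/
noncomputable def a : ABTilde := ⟨PowerSeries.C X⟩

/-- The generator `b`. -/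
noncomputable def b : ABTilde := ⟨PowerSeries.X⟩

/-- The coefficient of `a^p b^ν` in `x`. -/
noncomputable def coeff (x : ABTilde) (p ν : ℕ) : ℂ := (PowerSeries.coeff ν x.series).coeff p

lemma dA_X : dA PowerSeries.X = 0 := by
  ext1 n; simp only [dA, LinearMap.coe_mk, AddHom.coe_mk, PowerSeries.coeff_mk, PowerSeries.coeff_X]
  split_ifs <;> simp

lemma dB_C (p : ℂ[X]) : dB (PowerSeries.C p) = 0 := by simp [dB]

lemma series_mul_b (x : ABTilde) : (x * b).series = x.series * PowerSeries.X :=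
  star_of_dA dA_X _

lemma series_a_mul (x : ABTilde) : (a * x).series = PowerSeries.C X * x.series :=
  star_of_dB (dB_C X) _

/-- The defining relation. -/
theorem a_mul_b_sub : a * b - b * a = b ^ 2 := by
  have h1' : dA (PowerSeries.C (X : ℂ[X])) = 1 := by
    ext1 n
    simp only [dA, LinearMap.coe_mk, AddHom.coe_mk, PowerSeries.coeff_mk, PowerSeries.coeff_C,
      PowerSeries.coeff_one]
    split_ifs <;> simp
  have h1 : ∀ j, (dA ^ (j + 2)) (PowerSeries.C (X : ℂ[X])) = 0 := by
    intro j
    rw [pow_add, Module.End.mul_apply, pow_two, Module.End.mul_apply, h1', dA_one, map_zero]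
  have h2 : star PowerSeries.X (PowerSeries.C (X : ℂ[X]))
      = PowerSeries.X * PowerSeries.C (X : ℂ[X]) - PowerSeries.X ^ 2 := by
    have ht : ∀ j, term (j + 2) PowerSeries.X (PowerSeries.C (X : ℂ[X])) = 0 := fun j => by
      simp [term, h1]
    have h0 : term 0 PowerSeries.X (PowerSeries.C (X : ℂ[X]))
      = PowerSeries.X * PowerSeries.C (X : ℂ[X]) := by simp [term]
    have h3 : term 1 PowerSeries.X (PowerSeries.C (X : ℂ[X])) = - PowerSeries.X ^ 2 := by
      simp [term, h1', dB]
    have hs : ∀ n, ∑ j ∈ Finset.range (n + 2), term j PowerSeries.X (PowerSeries.C (X : ℂ[X]))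
        = PowerSeries.X * PowerSeries.C (X : ℂ[X]) - PowerSeries.X ^ 2 := by
      intro n
      rw [Finset.sum_range_succ', Finset.sum_range_succ']
      simp only [add_assoc, Nat.reduceAdd, ht, Finset.sum_const_zero, zero_add, h0, h3]
      ring
    ext1 n
    have := star_congr (n + 2) PowerSeries.X (PowerSeries.C (X : ℂ[X]))
    rw [hs, PowerSeries.X_pow_dvd_iff] at this
    have := this n (by omega)
    rwa [map_sub, sub_eq_zero] at this
  apply ABTilde.ext
  rw [pow_two, series_sub, series_mul_b, series_mul_b, series_mul]
  simp only [a, b, h2]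
  ring

lemma aeval_a (P : ℂ[X]) : Polynomial.aeval a P = ⟨PowerSeries.C P⟩ := by
  have hpow : ∀ n, (a ^ n).series = PowerSeries.C ((X : ℂ[X]) ^ n) := by
    intro n
    induction n with
    | zero => simp
    | succ n ih => rw [pow_succ', series_a_mul, ih, pow_succ', map_mul]
  induction P using Polynomial.induction_on' with
  | add p q hp hq => rw [map_add, hp, hq, map_add]; rfl
  | monomial n c =>
    rw [Polynomial.aeval_monomial, ← Algebra.smul_def]
    apply ABTilde.ext
    ext1 m
    rw [series_smul, hpow, coeff_smul', PowerSeries.coeff_C, PowerSeries.coeff_C,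
      ← Polynomial.C_mul_X_pow_eq_monomial, ← Polynomial.smul_eq_C_mul]
    split_ifs <;> simp

/-- The element `P(a) b^n` is the series with the single coefficient `P`, at place `n`. -/
theorem aeval_a_mul_b_pow (P : ℂ[X]) (n : ℕ) :
    Polynomial.aeval a P * b ^ n = ⟨PowerSeries.monomial n P⟩ := by
  induction n with
  | zero => rw [pow_zero, mul_one, aeval_a, PowerSeries.monomial_zero_eq_C_apply]
  | succ n ih =>
    rw [pow_succ, ← mul_assoc, ih]
    apply ABTilde.ext
    rw [series_mul_b]
    ext1 m
    cases m <;> simp [PowerSeries.coeff_succ_mul_X, PowerSeries.coeff_monomial]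

/-- The inclusion `ℂ[[b]] ⊂ Ã`. -/
noncomputable def ofB : PowerSeries ℂ →ₐ[ℂ] ABTilde where
  toFun S := ⟨PowerSeries.map Polynomial.C S⟩
  map_one' := ABTilde.ext (map_one (PowerSeries.map Polynomial.C))
  map_mul' S T := by
    have h : dA (PowerSeries.map (Polynomial.C : ℂ →+* ℂ[X]) T) = 0 := by
      ext1 n; simp [dA]
    apply ABTilde.ext
    rw [series_mul, star_of_dA h, map_mul]
  map_zero' := ABTilde.ext (map_zero (PowerSeries.map Polynomial.C))
  map_add' S T := ABTilde.ext (map_add (PowerSeries.map Polynomial.C) S T)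
  commutes' c := by
    rw [Algebra.algebraMap_eq_smul_one (A := ABTilde)]
    apply ABTilde.ext
    ext1 n
    rw [series_smul, coeff_smul', series_one, PowerSeries.coeff_one]
    simp only [PowerSeries.algebraMap_apply, Algebra.algebraMap_self, RingHom.id_apply,
      PowerSeries.map_C, PowerSeries.coeff_C]
    split_ifs <;> simp [Polynomial.smul_eq_C_mul]

lemma ofB_X : ofB PowerSeries.X = b :=
  ABTilde.ext (PowerSeries.map_X Polynomial.C)

lemma exists_b_mul (x : ABTilde) : ∃ y : ABTilde, b * x = y * b := by
  have h : PowerSeries.X ∣ star PowerSeries.X x.series := by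
    have h1 := star_congr 1 PowerSeries.X x.series
    rw [pow_one, Finset.sum_range_one] at h1
    have h2 : PowerSeries.X ∣ term 0 PowerSeries.X x.series := by
      simp [term]
    have := dvd_add h1 h2
    rwa [sub_add_cancel] at this
  obtain ⟨y, hy⟩ := h
  refine ⟨⟨y⟩, ABTilde.ext ?_⟩
  rw [series_mul_b, mul_comm]
  exact hy

lemma exists_b_pow_mul (n : ℕ) (x : ABTilde) : ∃ y : ABTilde, b ^ n * x = y * b ^ n := by
  induction n generalizing x with
  | zero => exact ⟨x, by simp⟩
  | succ n ih =>
    obtain ⟨y, hy⟩ := exists_b_mul x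
    obtain ⟨z, hz⟩ := ih y
    exact ⟨z, by rw [pow_succ, mul_assoc, hy, ← mul_assoc, hz, mul_assoc]⟩

lemma mul_b_pow_cancel (n : ℕ) {x y : ABTilde} (h : x * b ^ n = y * b ^ n) : x = y := by
  induction n with
  | zero => simpa using h
  | succ n ih =>
    apply ih
    rw [pow_succ, ← mul_assoc, ← mul_assoc] at h
    have h' := congrArg series h
    rw [series_mul_b, series_mul_b] at h'
    exact ABTilde.ext (PowerSeries.mul_X_cancel h')

lemma exists_oreNum (x : ABTilde) (s : Submonoid.powers b) :
    ∃ y : ABTilde, (s : ABTilde) * x = y * s := by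
  obtain ⟨_, n, rfl⟩ := s
  exact exists_b_pow_mul n x

/-- The powers of `b` form an Ore set of `Ã`. -/
noncomputable instance : OreLocalization.OreSet (Submonoid.powers b) where
  ore_right_cancel x y s h := by
    obtain ⟨_, n, rfl⟩ := s
    exact ⟨1, by rw [mul_b_pow_cancel n h]⟩
  oreNum x s := (exists_oreNum x s).choose
  oreDenom _ s := s
  ore_eq x s := (exists_oreNum x s).choose_spec

/-- `x` is homogeneous of degree `d` in `(a,b)`; such an `x` is a polynomial in `a` and `b`. -/
def IsHomogeneous (x : ABTilde) (d : ℕ) : Prop :=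
  ∀ p ν : ℕ, coeff x p ν ≠ 0 → p + ν = d

/-- `y` is the initial form of `x` in `(a,b)`, and it is of degree `d`: the non-zero homogeneous
component of smallest degree of `x`. -/
def IsInitialForm (x y : ABTilde) (d : ℕ) : Prop :=
  IsHomogeneous y d ∧ y ≠ 0 ∧ ∀ p ν : ℕ, p + ν ≤ d → coeff x p ν = coeff y p ν

/-- `x` is homogeneous of degree `d` in `(a,b)` and monic in `a`: `x = a^d + ⋯`. -/
def IsMonicForm (x : ABTilde) (d : ℕ) : Prop :=
  IsHomogeneous x d ∧ coeff x d 0 = 1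

/-- The ring `Ã[b⁻¹]`; it contains `𝒜[b⁻¹]`. -/
abbrev Loc : Type := OreLocalization (Submonoid.powers b) ABTilde

/-- The canonical map `Ã → Ã[b⁻¹]`. -/
noncomputable def toLoc : ABTilde →+* Loc := OreLocalization.numeratorRingHom

/-- The element `b`, as a unit of `Ã[b⁻¹]`. -/
noncomputable def bUnit : Locˣ :=
  OreLocalization.numeratorUnit (⟨b, Submonoid.mem_powers b⟩ : Submonoid.powers b)

/-- The element `b⁻¹ a` of `Ã[b⁻¹]`. -/
noncomputable def bInvA : Loc := ((bUnit⁻¹ : Locˣ) : Loc) * toLoc a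

lemma coe_bUnit : (bUnit : Loc) = toLoc b := rfl

/-- `b⁻¹a · b = b · b⁻¹a + b`. -/
lemma bInvA_mul_b : bInvA * toLoc b = toLoc b * bInvA + toLoc b := by
  have h : a * b = b * a + b * b := by
    have := a_mul_b_sub
    rw [pow_two] at this
    rw [← this]; abel
  have h1 : toLoc b * bInvA = toLoc a := by
    rw [bInvA, ← coe_bUnit, Units.mul_inv_cancel_left]
  rw [h1, bInvA, mul_assoc, ← map_mul, h, ← mul_add, map_mul, ← coe_bUnit,
    Units.inv_mul_cancel_left, map_add, coe_bUnit]

end ABTilde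

namespace ABModule

open ABTilde

section

variable (F : Type*) [AddCommGroup F] [Module ABTilde F]

/-- The `ℂ[[b]]`-module underlying a left `Ã`-module. -/
noncomputable abbrev bModule : Module (PowerSeries ℂ) F :=
  Module.compHom F (ofB : PowerSeries ℂ →+* ABTilde)

/-- An (a,b)-module: a left `Ã`-module which is free of finite type over `ℂ[[b]]`. -/
def IsABModule : Prop :=
  letI := bModule F
  Module.Free (PowerSeries ℂ) F ∧ Module.Finite (PowerSeries ℂ) F

/-- The rank over `ℂ[[b]]`. -/
noncomputable def rank : ℕ :=
  letI := bModule F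
  Module.finrank (PowerSeries ℂ) F

/-- The localization `F[b⁻¹]`. -/
def LocMod : Type _ := OreLocalization (Submonoid.powers b) F

noncomputable instance : AddCommGroup (LocMod F) :=
  inferInstanceAs (AddCommGroup (OreLocalization (Submonoid.powers b) F))

noncomputable instance : Module ABTilde.Loc (LocMod F) :=
  inferInstanceAs (Module ABTilde.Loc (OreLocalization (Submonoid.powers b) F))

noncomputable instance : Module (PowerSeries ℂ) (LocMod F) :=
  Module.compHom (LocMod F) (toLoc.comp (ofB : PowerSeries ℂ →+* ABTilde))

noncomputable instance : Module ℂ (LocMod F) :=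
  Module.compHom (LocMod F) (algebraMap ℂ (PowerSeries ℂ))

instance : IsScalarTower ℂ (PowerSeries ℂ) (LocMod F) :=
  IsScalarTower.of_algebraMap_smul fun _ _ => rfl

variable {F} in
lemma series_smul_def (S : PowerSeries ℂ) (v : LocMod F) : S • v = toLoc (ofB S) • v := rfl

variable {F} in
/-- The canonical map `F → F[b⁻¹]`. -/
noncomputable def incl (x : F) : LocMod F :=
  (OreLocalization.oreDiv x 1 : OreLocalization (Submonoid.powers b) F)

/-- The saturation `F^♯` of `F` by `b⁻¹a`: the smallest `ℂ[[b]]`-submodule of `F[b⁻¹]` which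
contains `F` and is stable by `b⁻¹a`. -/
noncomputable def saturation : Submodule (PowerSeries ℂ) (LocMod F) :=
  sInf {N | (∀ x : F, incl x ∈ N) ∧ ∀ v ∈ N, bInvA • v ∈ N}

variable {F} in
lemma bInvA_smul_mem {v : LocMod F} (hv : v ∈ saturation F) : bInvA • v ∈ saturation F := by
  rw [saturation, Submodule.mem_sInf] at hv ⊢
  exact fun N hN => hN.2 v (hv N hN)

lemma bInvA_smul_comm (c : ℂ) (v : LocMod F) : bInvA • (c • v) = c • (bInvA • v) := by
  have h : ∀ w : LocMod F, c • w = algebraMap ℂ ABTilde.Loc c • w := fun w => by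
    change ABTilde.toLoc (ofB (algebraMap ℂ (PowerSeries ℂ) c)) • w = _
    rw [AlgHom.commutes]
    rfl
  rw [h, h, smul_smul, smul_smul, Algebra.commutes]

/-- The action of `-b⁻¹a` on `F^♯`. -/
noncomputable def negBInvA : saturation F →ₗ[ℂ] saturation F where
  toFun v := ⟨-(bInvA • (v : LocMod F)), Submodule.neg_mem _ (bInvA_smul_mem v.2)⟩
  map_add' v w := by
    ext
    simp only [Submodule.coe_add, smul_add, neg_add]
  map_smul' c v := by
    ext
    simp only [Submodule.coe_smul_of_tower, bInvA_smul_comm, smul_neg, RingHom.id_apply]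

/-- The subspace `b F^♯` of `F^♯`. -/
noncomputable def bSaturation : Submodule ℂ (saturation F) :=
  (LinearMap.range (LinearMap.lsmul (PowerSeries ℂ) (saturation F) PowerSeries.X)).restrictScalars ℂ

lemma bSaturation_le_comap : bSaturation F ≤ (bSaturation F).comap (negBInvA F) := by
  rintro _ ⟨v, rfl⟩
  refine ⟨negBInvA F v - v, ?_⟩
  ext
  simp only [negBInvA, LinearMap.lsmul_apply, LinearMap.coe_mk, AddHom.coe_mk, Submodule.coe_smul,
    AddSubgroupClass.coe_sub, series_smul_def, ofB_X, smul_smul, bInvA_mul_b, smul_sub, smul_neg,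
    add_smul]
  abel

/-- The Bernstein polynomial of `F`: the minimal polynomial of the action of `-b⁻¹a` on the
vector space `F^♯ / b F^♯`. -/
noncomputable def bernsteinPolynomial : ℂ[X] :=
  minpoly ℂ ((bSaturation F).mapQ (bSaturation F) (negBInvA F) (bSaturation_le_comap F) :
    Module.End ℂ (saturation F ⧸ bSaturation F))

/-- `F` is regular: its saturation is of finite type over `ℂ[[b]]`. -/
def IsRegular : Prop := Module.Finite (PowerSeries ℂ) (saturation F)

/-- `F` is a geometric (a,b)-module: it is regular and the roots of its Bernstein polynomial are
negative rational numbers. -/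
def IsGeometric : Prop :=
  IsABModule F ∧ IsRegular F ∧
    ∀ z : ℂ, (bernsteinPolynomial F).IsRoot z → ∃ r : ℚ, r < 0 ∧ z = (r : ℂ)

/-- A fresco: a geometric (a,b)-module with one generator as a left `Ã`-module. -/
def IsFresco : Prop :=
  IsGeometric F ∧ ∃ e : F, Submodule.span ABTilde {e} = ⊤

/-- The Bernstein element `P_F = (-b)^k B_F(-b⁻¹a)` of a fresco `F` of rank `k`, as an element of
`𝒜[b⁻¹] ⊂ Ã[b⁻¹]`. -/
noncomputable def bernsteinElement : ABTilde.Loc :=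
  ((-bUnit) ^ rank F : ABTilde.Locˣ) * Polynomial.aeval (-bInvA) (bernsteinPolynomial F)

end

/-- `(a - λ₁ b) ⋯ (a - λ_k b)`. -/
noncomputable def linearProd {k : ℕ} (l : Fin k → ℂ) : ABTilde :=
  (List.ofFn fun j => a - l j • b).prod

/-- `(a - λ₁ b) S₁⁻¹ ⋯ (a - λ_k b) S_k⁻¹`. -/
noncomputable def twistedProd {k : ℕ} (l : Fin k → ℂ) (S : Fin k → PowerSeries ℂ) : ABTilde :=
  (List.ofFn fun j => (a - l j • b) * ofB (S j)⁻¹).prod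

end ABModule

/-! ### Normal ordering: multiplication by `a` and by `b` in `Ã` -/

namespace ABTilde

/-! Put `τ = -b⁻¹a`, so that `a = (-b)τ` and `τ(-b)^n = (-b)^n(τ - n)`. Homogeneous elements of
degree `d` are exactly the `(-b)^d f(τ)` with `deg f ≤ d`, the coefficient of `a^d` being that of
`τ^d` in `f` (`IsHomogeneous.exists_aeval`, `exists_isHomogeneous_of_natDegree_le`). Since `f ↦
f(τ)` is injective (`aeval_tau_injective`), questions about homogeneous elements become questions
about polynomials, up to the shifts caused by moving powers of `-b`.

The module side uses the filtration `b^n F^♯`. It is stable by `τ`, and `a` and `b` both raise its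
index by one, so an element of `Ã` of order at least `n` sends `F` into `b^n F^♯`. If `𝒬e = 0` has
initial form `Q = (-b)^q B_Q(τ)`, then `Qe = (Q - 𝒬)e` lies in `b^(q+1) F^♯`, hence `B_Q(τ)e` lies
in `b F^♯`. By Nakayama the elements `τ^j e` generate `F^♯`, so `e` is cyclic in `F^♯/bF^♯`; what
kills its class kills the quotient, and `B_F` divides `B_Q` (`bernsteinPolynomial_dvd`).

Regularity gives `F^♯` the same rank `k` as `F`, so `F^♯/bF^♯` has dimension `k`; cyclicity forces
its minimal polynomial to have degree `k` (`natDegree_bernsteinPolynomial`). Therefore `P_F = (-b)^k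
B_F(τ)` is a monic form of degree `k`, and `q ≥ k`. Writing `B_Q = C·B_F`, the element `W =
(-b)^(q-k) C(τ + k)` satisfies `W P_F = Q`, because `C(τ + k)(-b)^k = (-b)^k C(τ)`.

For a presentation by `Π`, each factor `S_j⁻¹` is `1` modulo `b`, so the product of the `a - λ_j b`
sends the canonical generator into `b^(k+1) F^♯`. Its polynomial is monic of degree `k` and
divisible by `B_F`, hence equal to it. -/

lemma series_mul_a (x : ABTilde) :
    (x * a).series = x.series * PowerSeries.C X + dB x.series := by
  have h1' : dA (PowerSeries.C (X : ℂ[X])) = 1 := by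
    ext1 n
    simp only [dA, LinearMap.coe_mk, AddHom.coe_mk, PowerSeries.coeff_mk, PowerSeries.coeff_C,
      PowerSeries.coeff_one]
    split_ifs <;> simp
  have h1 : ∀ j, (dA ^ (j + 2)) (PowerSeries.C (X : ℂ[X])) = 0 := by
    intro j
    rw [pow_add, Module.End.mul_apply, pow_two, Module.End.mul_apply, h1', dA_one, map_zero]
  have ht : ∀ j, term (j + 2) x.series (PowerSeries.C (X : ℂ[X])) = 0 := fun j => by
    simp [term, h1]
  ext1 n
  have := star_congr (n + 2) x.series (PowerSeries.C (X : ℂ[X]))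
  rw [Finset.sum_range_succ', Finset.sum_range_succ', PowerSeries.X_pow_dvd_iff] at this
  have := this n (by omega)
  rw [map_sub, sub_eq_zero] at this
  rw [series_mul, a, this]
  congr 1
  simp only [add_assoc, Nat.reduceAdd, ht, Finset.sum_const_zero]
  simp [term, h1', add_comm]

/-- The commutation relation `a S(b) = S(b) a + b² S'(b)`. -/
lemma a_mul_ofB (S : PowerSeries ℂ) :
    a * ofB S = ofB S * a + b ^ 2 * ofB (PowerSeries.derivative ℂ S) := by
  rw [← ofB_X, ← map_pow, ← map_mul]
  apply ABTilde.ext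
  rw [series_add, series_a_mul, series_mul_a]
  ext n : 1
  simp only [ofB, dB, AlgHom.coe_mk, RingHom.coe_mk, MonoidHom.coe_mk, OneHom.coe_mk,
    LinearMap.coe_mk, AddHom.coe_mk, map_add, map_neg, PowerSeries.coeff_map,
    PowerSeries.coeff_X_pow_mul', PowerSeries.coeff_derivative, PowerSeries.coeff_mul_C,
    PowerSeries.coeff_C_mul]
  rw [mul_comm X]
  split_ifs <;> simp

lemma dB_pow_X (j : ℕ) : (dB ^ j) PowerSeries.X
    = ((-1) ^ j * (j.factorial : ℂ)) • (PowerSeries.X ^ (j + 1) : PowerSeries ℂ[X]) := by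
  induction j with
  | zero => simp
  | succ j ih =>
    rw [pow_succ', Module.End.mul_apply, ih, map_smul]
    have : dB (PowerSeries.X ^ (j + 1) : PowerSeries ℂ[X])
        = (-((j : ℂ) + 1)) • PowerSeries.X ^ (j + 1 + 1) := by
      ext n : 1
      simp only [dB, LinearMap.coe_mk, AddHom.coe_mk, map_neg, coeff_smul',
        PowerSeries.coeff_X_pow_mul', PowerSeries.coeff_derivative, PowerSeries.coeff_X_pow]
      by_cases h : n = j + 1 + 1
      · subst h
        simp [Polynomial.smul_eq_C_mul]
      · rw [if_neg h]
        split_ifs with h2 h3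
        · omega
        · simp
        · simp
    rw [this, smul_smul, Nat.factorial_succ]
    congr 1
    push_cast
    ring

/-- The factorial in `(-b² d/db)^j b = (-1)^j j! b^(j+1)` cancels the `1/j!` of `term`: left
multiplication by `b` is a geometric series in `b d/da`. -/
lemma term_X (j : ℕ) (g : PowerSeries ℂ[X]) :
    term j PowerSeries.X g = ((-1 : ℂ) ^ j) • (PowerSeries.X ^ (j + 1) * (dA ^ j) g) := by
  rw [term, dB_pow_X, smul_mul_assoc, smul_smul]
  congr 1
  have : (j.factorial : ℂ) ≠ 0 := by exact_mod_cast j.factorial_ne_zero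
  field_simp

lemma dA_X_mul (f : PowerSeries ℂ[X]) : dA (PowerSeries.X * f) = PowerSeries.X * dA f := by
  rw [dA_mul, dA_X, zero_mul, zero_add]

lemma dA_pow_X_mul (j : ℕ) (f : PowerSeries ℂ[X]) :
    (dA ^ j) (PowerSeries.X * f) = PowerSeries.X * (dA ^ j) f := by
  induction j with
  | zero => simp
  | succ j ih => rw [pow_succ', Module.End.mul_apply, ih, dA_X_mul, Module.End.mul_apply]

/-- On normally ordered series, left multiplication by `b` is `b (1 + b d/da)⁻¹`, so the witness is
`(1 + b d/da) x`. The partial sums telescope, with a remainder divisible by `b^(n+1)`. -/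
lemma exists_mul_b (x : ABTilde) : ∃ y : ABTilde, x * b = b * y := by
  refine ⟨⟨x.series + PowerSeries.X * dA x.series⟩, ABTilde.ext ?_⟩
  rw [series_mul_b, series_mul]
  have key : ∀ n, ∑ j ∈ Finset.range n,
      term j PowerSeries.X (x.series + PowerSeries.X * dA x.series)
      = x.series * PowerSeries.X
        - ((-1 : ℂ) ^ n) • (PowerSeries.X ^ (n + 1) * (dA ^ n) x.series) := by
    intro n
    induction n with
    | zero => simp [mul_comm]
    | succ n ih =>
      rw [Finset.sum_range_succ, ih, term_X, map_add, dA_pow_X_mul, mul_add, ← mul_assoc,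
        ← pow_succ, smul_add, ← Module.End.mul_apply, ← pow_succ, pow_succ (-1 : ℂ)]
      rw [mul_neg_one, neg_smul]
      abel
  ext1 n
  have := star_congr (n + 1) PowerSeries.X (x.series + PowerSeries.X * dA x.series)
  rw [key, PowerSeries.X_pow_dvd_iff] at this
  have := this n (by omega)
  rw [map_sub, map_sub, sub_eq_zero, coeff_smul', PowerSeries.coeff_X_pow_mul',
    if_neg (by omega), smul_zero, sub_zero] at this
  exact this.symm

/-- The terms of `b * x` with `j ≥ 1` have higher order in `b`, so the lowest `b`-coefficient of `x`
survives, shifted by one. -/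
lemma eq_zero_of_b_mul {x : ABTilde} (h : b * x = 0) : x = 0 := by
  have key : ∀ n, PowerSeries.X ^ n ∣ x.series := by
    intro n
    induction n with
    | zero => simp
    | succ n ih =>
      have h0 := congrArg (fun y => PowerSeries.coeff (n + 1) y.series) h
      simp only [series_mul, series_zero, map_zero, star, PowerSeries.coeff_mk, b] at h0
      rw [Finset.sum_range_succ', Finset.sum_eq_zero, zero_add] at h0
      · rw [term_X] at h0
        rw [PowerSeries.X_pow_dvd_iff] at ih ⊢
        intro m hm
        rcases Nat.lt_succ_iff_lt_or_eq.mp hm with hm | rfl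
        · exact ih m hm
        · simpa [PowerSeries.coeff_succ_X_mul] using h0
      · intro j _
        have : PowerSeries.X ^ (j + 1 + 1 + n) ∣ term (j + 1) PowerSeries.X x.series := by
          rw [term_X]
          refine dvd_smul_C _ ?_
          rw [pow_add _ (j + 1 + 1) n]
          exact mul_dvd_mul_left _ (X_pow_dvd_dA_pow ih _)
        exact PowerSeries.X_pow_dvd_iff.mp this (n + 1) (by omega)
  apply ABTilde.ext
  ext1 n
  exact (PowerSeries.X_pow_dvd_iff.mp (key (n + 1))) n (by omega)

lemma toLoc_injective : Function.Injective toLoc := by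
  refine OreLocalization.numeratorHom_inj (S := Submonoid.powers b) ?_
  rintro _ ⟨n, rfl⟩
  rw [mem_nonZeroDivisorsLeft_iff]
  intro x hx
  induction n with
  | zero => simpa using hx
  | succ n ih =>
    simp only [pow_succ', mul_assoc] at hx
    exact ih (eq_zero_of_b_mul hx)

/-- Division by `a` on the left, free of corrections because `a` stands on the left in normal order.
It drives the inductions on the degree in `(a,b)`. -/
lemma exists_eq_a_mul_add (x : ABTilde) : ∃ (y : ABTilde) (S : PowerSeries ℂ),
    x = a * y + ofB S ∧ (∀ p ν, coeff y p ν = coeff x (p + 1) ν) ∧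
      ∀ ν, PowerSeries.coeff ν S = coeff x 0 ν := by
  refine ⟨⟨PowerSeries.mk fun n => (PowerSeries.coeff n x.series).divX⟩,
    PowerSeries.mk fun n => coeff x 0 n, ABTilde.ext ?_, ?_, ?_⟩
  · ext n : 1
    rw [series_add, series_a_mul]
    simp [ofB, coeff, Polynomial.X_mul_divX_add]
  · intro p ν
    simp [coeff, Polynomial.coeff_divX]
  · simp

/-! ### Homogeneous elements as polynomials in `τ` -/

lemma ext_coeff {x y : ABTilde} (h : ∀ p ν, coeff x p ν = coeff y p ν) : x = y :=
  ABTilde.ext (PowerSeries.ext fun ν => Polynomial.ext fun p => h p ν)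

lemma coeff_add (x y : ABTilde) (p ν : ℕ) : coeff (x + y) p ν = coeff x p ν + coeff y p ν := by
  simp [coeff]

lemma coeff_sub (x y : ABTilde) (p ν : ℕ) : coeff (x - y) p ν = coeff x p ν - coeff y p ν := by
  simp [coeff]

lemma coeff_a_mul_zero (x : ABTilde) (ν : ℕ) : coeff (a * x) 0 ν = 0 := by
  simp [coeff, series_a_mul]

lemma coeff_a_mul_succ (x : ABTilde) (p ν : ℕ) : coeff (a * x) (p + 1) ν = coeff x p ν := by
  simp [coeff, series_a_mul]

lemma coeff_ofB (S : PowerSeries ℂ) (p ν : ℕ) :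
    coeff (ofB S) p ν = if p = 0 then PowerSeries.coeff ν S else 0 := by
  simp [coeff, ofB, Polynomial.coeff_C]

/-- The unit `-b` of `Ã[b⁻¹]`. -/
noncomputable abbrev negB : Locˣ := -bUnit

/-- The element `-b⁻¹a` of `Ã[b⁻¹]`. -/
noncomputable abbrev tau : Loc := -bInvA

lemma coe_negB : (negB : Loc) = -toLoc b := rfl

lemma toLoc_smul (c : ℂ) (x : ABTilde) : toLoc (c • x) = algebraMap ℂ Loc c * toLoc x := by
  rw [Algebra.smul_def, map_mul]
  rfl

lemma negB_mul_tau : (negB : Loc) * tau = toLoc a := by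
  rw [tau, bInvA, coe_negB, neg_mul_neg, ← coe_bUnit, Units.mul_inv_cancel_left]

lemma tau_mul_negB_pow (n : ℕ) : tau * (negB : Loc) ^ n = (negB : Loc) ^ n * (tau - n) := by
  induction n with
  | zero => simp
  | succ n ih =>
    have h1 : tau * (negB : Loc) = negB * (tau - 1) := by
      rw [tau, coe_negB, neg_mul_neg, bInvA_mul_b]
      noncomm_ring
    rw [pow_succ, ← mul_assoc, ih, mul_assoc, sub_mul, h1, mul_assoc, Nat.cast_comm, ← mul_sub]
    push_cast
    rw [sub_sub, add_comm (1 : Loc)]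

/-- Conjugation by `(-b)^n` translates `τ` by `n`; this is the source of every shift in the
factorization of `Q`. -/
lemma aeval_tau_mul_negB_pow (f : ℂ[X]) (n : ℕ) : aeval tau f * (negB : Loc) ^ n
    = (negB : Loc) ^ n * aeval tau (f.comp (X - C (n : ℂ))) := by
  have hX : aeval tau (X - C (n : ℂ)) = tau - n := by simp
  induction f using Polynomial.induction_on' with
  | add p q hp hq => rw [map_add, add_mul, hp, hq, add_comp, map_add, mul_add]
  | monomial m c =>
    rw [aeval_comp, hX, aeval_monomial, aeval_monomial, ← mul_assoc, ← Algebra.commutes c,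
      mul_assoc, mul_assoc]
    congr 1
    induction m with
    | zero => simp
    | succ m ih => rw [pow_succ', mul_assoc, ih, ← mul_assoc, tau_mul_negB_pow, mul_assoc, pow_succ']

lemma toLoc_a_mul (d : ℕ) (g : ℂ[X]) : toLoc a * ((negB : Loc) ^ d * aeval tau g)
    = (negB : Loc) ^ (d + 1) * aeval tau ((X - C (d : ℂ)) * g) := by
  rw [← negB_mul_tau, map_mul, ← mul_assoc, mul_assoc _ tau, tau_mul_negB_pow, ← mul_assoc,
    ← pow_succ']
  simp [mul_assoc]

lemma toLoc_ofB_monomial (d : ℕ) (c : ℂ) : toLoc (ofB (PowerSeries.monomial d c))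
    = (negB : Loc) ^ d * aeval tau (C ((-1) ^ d * c)) := by
  have : PowerSeries.monomial d c = c • PowerSeries.X ^ d := by
    rw [PowerSeries.X_pow_eq, ← map_smul, smul_eq_mul, mul_one]
  rw [this, map_smul, map_pow, ofB_X, toLoc_smul, aeval_C, coe_negB, map_pow, neg_pow,
    map_mul, map_pow, map_neg, map_one]
  rw [Algebra.commutes, ← mul_assoc _ _ (algebraMap ℂ Loc c)]
  congr 1
  rcases neg_one_pow_eq_or Loc d with h | h <;> rw [h] <;> simp

lemma IsHomogeneous.exists_aeval {x : ABTilde} {d : ℕ} (hx : IsHomogeneous x d) :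
    ∃ f : ℂ[X], f.natDegree ≤ d ∧ f.coeff d = coeff x d 0 ∧
      toLoc x = (negB : Loc) ^ d * aeval tau f := by
  induction d generalizing x with
  | zero =>
    refine ⟨C (coeff x 0 0), by simp, by simp, ?_⟩
    have : x = ofB (PowerSeries.monomial 0 (coeff x 0 0)) := by
      refine ext_coeff fun p ν => ?_
      rw [coeff_ofB, PowerSeries.coeff_monomial]
      have := hx p ν
      split_ifs with h1 h2
      · rw [h1, h2]
      · by_contra h; have := this h; omega
      · by_contra h; have := this h; omega
    rw [this, toLoc_ofB_monomial, ← this]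
    simp
  | succ d ih =>
    obtain ⟨y, S, h, hy, hS⟩ := exists_eq_a_mul_add x
    obtain ⟨g, hg, hgc, hg'⟩ := ih (x := y) fun p ν hp => by
      rw [hy] at hp
      have := hx _ _ hp
      omega
    have hSm : S = PowerSeries.monomial (d + 1) (coeff x 0 (d + 1)) := by
      ext ν
      rw [hS, PowerSeries.coeff_monomial]
      split_ifs with h1
      · rw [h1]
      · by_contra h
        have := hx _ _ h
        omega
    -- The first summand is `a * y`, by `toLoc_a_mul`; the second is the pure power of `b`, with the
    -- sign of `b^(d+1) = (-1)^(d+1) (-b)^(d+1)`.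
    refine ⟨(X - C (d : ℂ)) * g + C ((-1) ^ (d + 1) * coeff x 0 (d + 1)), ?_, ?_, ?_⟩
    · refine (natDegree_add_le _ _).trans (max_le ?_ (by rw [natDegree_C]; omega))
      refine natDegree_mul_le.trans ?_
      rw [natDegree_X_sub_C]
      omega
    · rw [Polynomial.coeff_add, coeff_C_succ, sub_mul, Polynomial.coeff_sub, coeff_X_mul,
        coeff_C_mul, coeff_eq_zero_of_natDegree_lt (Nat.lt_succ_of_le hg), hgc, hy]
      simp
    · rw [map_add, mul_add, ← toLoc_ofB_monomial, ← hSm, ← toLoc_a_mul, ← hg', ← map_mul, ← map_add,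
        ← h]

lemma exists_isHomogeneous_of_natDegree_le {d : ℕ} {f : ℂ[X]} (hf : f.natDegree ≤ d) :
    ∃ x : ABTilde, IsHomogeneous x d ∧ coeff x d 0 = f.coeff d ∧
      toLoc x = (negB : Loc) ^ d * aeval tau f := by
  induction d generalizing f with
  | zero =>
    refine ⟨ofB (PowerSeries.monomial 0 (f.coeff 0)), ?_, ?_, ?_⟩
    · intro p ν h
      rw [coeff_ofB, PowerSeries.coeff_monomial] at h
      split_ifs at h with h1 h2 <;> simp_all
    · simp [coeff_ofB]
    · rw [toLoc_ofB_monomial]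
      conv_rhs => rw [eq_C_of_natDegree_le_zero hf]
      simp
  | succ d ih =>
    have hm : (X - C (d : ℂ)).Monic := monic_X_sub_C _
    -- Left multiplication by `a` in degree `d` multiplies the polynomial by `X - d`, so dividing by
    -- `X - d` splits off a left factor `a`; the remainder `f(d)` becomes a multiple of `b^(d+1)`.
    set g := f /ₘ (X - C (d : ℂ)) with hgdef
    have hfg : f = (X - C (d : ℂ)) * g + C (f.eval (d : ℂ)) := by
      rw [← modByMonic_X_sub_C_eq_C_eval, add_comm, modByMonic_add_div]
    have hg : g.natDegree ≤ d := by
      rw [hgdef, natDegree_divByMonic _ hm, natDegree_X_sub_C]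
      omega
    obtain ⟨y, hy, hyc, hy'⟩ := ih hg
    refine ⟨a * y + ofB (PowerSeries.monomial (d + 1) ((-1) ^ (d + 1) * f.eval (d : ℂ))),
      ?_, ?_, ?_⟩
    · intro p ν h
      rw [coeff_add, coeff_ofB, PowerSeries.coeff_monomial] at h
      rcases p with _ | p
      · rw [coeff_a_mul_zero, if_pos rfl, zero_add, ite_ne_right_iff] at h
        omega
      · rw [coeff_a_mul_succ, if_neg (by omega), add_zero] at h
        have := hy _ _ h
        omega
    · rw [coeff_add, coeff_a_mul_succ, coeff_ofB, if_neg (Nat.succ_ne_zero _),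
        add_zero, hyc]
      conv_rhs => rw [hfg]
      rw [Polynomial.coeff_add, coeff_C_succ, sub_mul, Polynomial.coeff_sub, coeff_X_mul,
        coeff_C_mul, coeff_eq_zero_of_natDegree_lt (Nat.lt_succ_of_le hg)]
      simp
    · rw [map_add, map_mul, hy', toLoc_a_mul, toLoc_ofB_monomial, ← mul_assoc ((-1) ^ (d + 1)),
        ← mul_pow, neg_one_mul, neg_neg, one_pow, one_mul, ← mul_add, ← map_add, ← hfg]

lemma exists_isMonicForm {d : ℕ} {f : ℂ[X]} (hf : f.Monic) (hd : f.natDegree = d) :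
    ∃ x : ABTilde, IsMonicForm x d ∧ toLoc x = (negB : Loc) ^ d * aeval tau f := by
  obtain ⟨x, h1, h2, h3⟩ := exists_isHomogeneous_of_natDegree_le hd.le
  exact ⟨x, ⟨h1, by rw [h2, ← hd]; exact hf⟩, h3⟩

lemma IsMonicForm.exists_aeval {x : ABTilde} {d : ℕ} (hx : IsMonicForm x d) :
    ∃ f : ℂ[X], f.Monic ∧ f.natDegree = d ∧ toLoc x = (negB : Loc) ^ d * aeval tau f := by
  obtain ⟨f, h1, h2, h3⟩ := hx.1.exists_aeval
  rw [hx.2] at h2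
  refine ⟨f, monic_of_natDegree_le_of_coeff_eq_one d h1 h2, ?_, h3⟩
  exact le_antisymm h1 (le_natDegree_of_ne_zero (by rw [h2]; exact one_ne_zero))

/-- If `f(τ) = 0`, the homogeneous element attached to `f` in degree `deg f` vanishes, and its
coefficient on the top power of `a` is the leading coefficient of `f`. -/
lemma aeval_tau_injective : Function.Injective (aeval tau : ℂ[X] → Loc) := by
  rw [injective_iff_map_eq_zero]
  intro f hf
  obtain ⟨x, -, h2, h3⟩ := exists_isHomogeneous_of_natDegree_le (le_refl f.natDegree)
  rw [hf, mul_zero, map_eq_zero_iff _ toLoc_injective] at h3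
  rw [h3] at h2
  rw [← leadingCoeff_eq_zero]
  exact h2.symm

end ABTilde

/-! ### The localization `F[b⁻¹]` and generators of the saturation -/

namespace ABTilde

lemma toLoc_b : toLoc b = -(negB : Loc) := by
  rw [coe_negB, neg_neg]

lemma toLoc_ofB_X : toLoc (ofB PowerSeries.X) = -(negB : Loc) := by
  rw [ofB_X, toLoc_b]

lemma toLoc_ofB_X_pow (n : ℕ) : toLoc (ofB (PowerSeries.X ^ n)) = (-1) ^ n * (negB : Loc) ^ n := by
  rw [map_pow, map_pow, toLoc_ofB_X, neg_pow]

lemma isUnit_toLoc_ofB {S : PowerSeries ℂ} (hS : S ≠ 0) : IsUnit (toLoc (ofB S)) := by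
  rw [← PowerSeries.X_pow_order_mul_divXPowOrder (f := S), map_mul, map_mul, map_pow, map_pow,
    toLoc_ofB_X]
  exact ((Units.isUnit (-negB)).pow _).mul
    (((PowerSeries.isUnit_divided_by_X_pow_order hS).map ofB).map toLoc)

/-- `(-b⁻¹a) S(b) = S(b) (-b⁻¹a) - b S'(b)`. -/
lemma tau_mul_ofB (S : PowerSeries ℂ) : tau * toLoc (ofB S)
    = toLoc (ofB S) * tau - toLoc (ofB (PowerSeries.X * PowerSeries.derivative ℂ S)) := by
  have h := congrArg toLoc (a_mul_ofB S)
  have hc : (negB : Loc) * toLoc (ofB S) = toLoc (ofB S) * negB := by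
    have hX : (negB : Loc) = toLoc (ofB (-PowerSeries.X)) := by
      rw [map_neg, map_neg, toLoc_ofB_X, neg_neg]
    rw [hX, ← map_mul, ← map_mul, ← map_mul, ← map_mul, mul_comm]
  rw [map_add, map_mul, map_mul, ← negB_mul_tau, ← mul_assoc, ← hc, map_mul, map_pow, toLoc_b,
    neg_sq, pow_two] at h
  refine (Units.mul_right_inj negB).mp ?_
  rw [← mul_assoc, h, mul_sub, map_mul ofB, map_mul toLoc, toLoc_ofB_X]
  noncomm_ring

end ABTilde

namespace ABModule

open ABTilde

variable {F : Type*} [AddCommGroup F] [Module ABTilde F]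

lemma toLoc_smul_incl (x : ABTilde) (v : F) : toLoc x • incl v = incl (x • v) := by
  refine (OreLocalization.oreDiv_smul_char x v 1 1 x 1 (by simp)).trans ?_
  rw [one_mul]
  rfl

lemma incl_add (v w : F) : incl (v + w) = incl v + incl w :=
  (OreLocalization.add_oreDiv (r := v) (r' := w) (s := (1 : Submonoid.powers b))).symm

lemma incl_zero : incl (0 : F) = 0 :=
  OreLocalization.zero_oreDiv (1 : Submonoid.powers b)

/-- The canonical map `F → F[b⁻¹]`, as a `ℂ[[b]]`-linear map. -/
noncomputable def inclLinear : letI := bModule F; F →ₗ[PowerSeries ℂ] LocMod F :=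
  letI := bModule F
  { toFun := incl
    map_add' := incl_add
    map_smul' := fun S v => (toLoc_smul_incl (ofB S) v).symm }

lemma exists_smul_eq_incl (v : LocMod F) : ∃ (n : ℕ) (x : F),
    (PowerSeries.X ^ n : PowerSeries ℂ) • v = incl x := by
  obtain ⟨⟨x, s⟩, rfl⟩ := Quotient.exists_rep v
  obtain ⟨_, n, rfl⟩ := s
  refine ⟨n, x, ?_⟩
  have hn : b ^ n ∈ Submonoid.powers b := (Submonoid.mem_powers_iff _ _).mpr ⟨n, rfl⟩
  change toLoc (ofB (PowerSeries.X ^ n)) •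
    (OreLocalization.oreDiv x (⟨b ^ n, hn⟩ : Submonoid.powers b) : LocMod F) = _
  rw [map_pow, ofB_X]
  refine (OreLocalization.oreDiv_smul_char (b ^ n) x 1 ⟨b ^ n, hn⟩ 1 1 (by simp)).trans ?_
  rw [one_mul, one_smul]
  rfl

instance : Module.IsTorsionFree (PowerSeries ℂ) (LocMod F) where
  isSMulRegular S hS v w h := by
    simp only [series_smul_def] at h
    obtain ⟨u, hu⟩ := isUnit_toLoc_ofB hS.ne_zero
    rw [← hu] at h
    have := congrArg (fun z => ((u⁻¹ : Locˣ) : Loc) • z) h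
    simpa only [smul_smul, Units.inv_mul, one_smul] using this

lemma incl_injective (hF : IsABModule F) : Function.Injective (incl : F → LocMod F) := by
  let _ := bModule F
  have := hF.1
  have hinj : Function.Injective (inclLinear (F := F)) := by
    rw [← LinearMap.ker_eq_bot, LinearMap.ker_eq_bot']
    intro x hx
    obtain ⟨u, v, h1, h2⟩ := OreLocalization.oreDiv_eq_iff.mp
      (show OreLocalization.oreDiv x (1 : Submonoid.powers b)
        = OreLocalization.oreDiv (0 : F) (1 : Submonoid.powers b) from hx.trans incl_zero.symm)
    obtain ⟨_, n, rfl⟩ := u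
    simp only [smul_zero, OneMemClass.coe_one, mul_one] at h1 h2
    rw [← h2, ← ofB_X, ← map_pow] at h1
    have h3 : (PowerSeries.X ^ n : PowerSeries ℂ) • x = 0 := h1.symm
    exact (smul_eq_zero.mp h3).resolve_left (pow_ne_zero _ PowerSeries.X_ne_zero)
  exact hinj

lemma exists_eq_aeval_add (x : ABTilde) : ∃ (P : ℂ[X]) (y : ABTilde), x = aeval a P + b * y := by
  obtain ⟨z, hz⟩ : ∃ z : ABTilde, x = aeval a (PowerSeries.constantCoeff x.series) + z * b := by
    refine ⟨⟨PowerSeries.mk fun n => PowerSeries.coeff (n + 1) x.series⟩, ABTilde.ext ?_⟩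
    rw [aeval_a, series_add, series_mul_b, add_comm]
    exact PowerSeries.eq_shift_mul_X_add_const _
  obtain ⟨y, hy⟩ := exists_mul_b z
  exact ⟨_, y, by rw [← hy, ← hz]⟩

/-- A generator `e` of an (a,b)-module and its images `a^j e` generate it over `ℂ[[b]]`. -/
lemma span_a_pow_smul (hF : IsABModule F) {e : F} (he : Submodule.span ABTilde {e} = ⊤) :
    letI := bModule F
    Submodule.span (PowerSeries ℂ) (Set.range fun j : ℕ => a ^ j • e) = ⊤ := by
  let _ := bModule F
  have := hF.2
  rw [eq_top_iff]
  -- Nakayama for the maximal ideal `(b)`: modulo `bF`, an element of `Ã` acts on `e` as a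
  -- polynomial in `a`.
  refine Submodule.le_of_le_smul_of_le_jacobson_bot (I := Ideal.span {PowerSeries.X})
    Module.Finite.fg_top ?_ ?_
  · rw [← PowerSeries.maximalIdeal_eq_span_X]
    exact IsLocalRing.maximalIdeal_le_jacobson _
  · intro v hv
    clear hv
    obtain ⟨x, rfl⟩ := Submodule.mem_span_singleton.mp (he ▸ Submodule.mem_top : v ∈ _)
    obtain ⟨P, y, rfl⟩ := exists_eq_aeval_add x
    rw [add_smul, mul_smul]
    refine Submodule.add_mem_sup ?_ ?_
    · induction P using Polynomial.induction_on' with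
      | add p q hp hq => rw [map_add, add_smul]; exact Submodule.add_mem _ hp hq
      | monomial n c =>
        rw [aeval_monomial, mul_smul, ← AlgHom.commutes ofB]
        exact Submodule.smul_mem _ (algebraMap ℂ (PowerSeries ℂ) c)
          (Submodule.subset_span ⟨n, rfl⟩)
    · rw [← ofB_X]
      exact Submodule.smul_mem_smul (Submodule.mem_span_singleton_self PowerSeries.X)
        (Submodule.mem_top (x := y • e))

lemma incl_mem_saturation (x : F) : incl x ∈ saturation F := by
  rw [saturation, Submodule.mem_sInf]
  exact fun N hN => hN.1 x

lemma tau_smul_mem {v : LocMod F} (hv : v ∈ saturation F) : tau • v ∈ saturation F := by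
  rw [tau, neg_smul]
  exact Submodule.neg_mem _ (bInvA_smul_mem hv)

lemma tau_smul_series (S : PowerSeries ℂ) (v : LocMod F) :
    tau • (S • v) = S • (tau • v) - (PowerSeries.X * PowerSeries.derivative ℂ S) • v := by
  simp only [series_smul_def, smul_smul, tau_mul_ofB, sub_smul]

lemma negB_smul (v : LocMod F) :
    (negB : Loc) • v = -((PowerSeries.X : PowerSeries ℂ) • v) := by
  rw [series_smul_def, toLoc_ofB_X, neg_smul, neg_neg]

/-- The saturation is generated over `ℂ[[b]]` by the elements `(-b⁻¹a)^j e`. -/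
lemma saturation_eq_span (hF : IsABModule F) {e : F} (he : Submodule.span ABTilde {e} = ⊤) :
    saturation F = Submodule.span (PowerSeries ℂ) (Set.range fun j : ℕ => tau ^ j • incl e) := by
  set N := Submodule.span (PowerSeries ℂ) (Set.range fun j : ℕ => tau ^ j • incl e) with hN
  have hτ : ∀ v ∈ N, tau • v ∈ N := by
    intro v hv
    induction hv using Submodule.span_induction with
    | mem x hx =>
      obtain ⟨j, rfl⟩ := hx
      exact Submodule.subset_span ⟨j + 1, by simp only [pow_succ', mul_smul]⟩
    | zero => rw [smul_zero]; exact N.zero_mem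
    | add x y _ _ hx hy => rw [smul_add]; exact N.add_mem hx hy
    | smul S x hx' hx =>
      rw [tau_smul_series]
      exact N.sub_mem (N.smul_mem _ hx) (N.smul_mem _ hx')
  have hapow : ∀ j : ℕ, toLoc (a ^ j) • incl e ∈ N := by
    intro j
    induction j with
    | zero => exact Submodule.subset_span ⟨0, by simp⟩
    | succ j ih =>
      rw [pow_succ', map_mul, mul_smul, ← negB_mul_tau, mul_smul, negB_smul]
      exact N.neg_mem (N.smul_mem _ (hτ _ ih))
  apply le_antisymm
  -- Minimality of the saturation: `N` is stable by `τ`, and contains `F` because `F` is spanned by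
  -- the `a^j e`, which lie in `N` since `a = (-b)τ`.
  · refine sInf_le ⟨fun x => ?_, fun v hv => ?_⟩
    · let _ := bModule F
      have hx : x ∈ Submodule.span (PowerSeries ℂ) (Set.range fun j : ℕ => a ^ j • e) :=
        (span_a_pow_smul hF he).symm ▸ Submodule.mem_top
      have : Submodule.span (PowerSeries ℂ) (Set.range fun j : ℕ => a ^ j • e)
          ≤ N.comap inclLinear := by
        rw [Submodule.span_le]
        rintro _ ⟨j, rfl⟩
        change incl (a ^ j • e) ∈ N
        rw [← toLoc_smul_incl]
        exact hapow j
      exact this hx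
    · have := N.neg_mem (hτ v hv)
      rwa [tau, neg_smul, neg_neg] at this
  · rw [hN, Submodule.span_le]
    rintro _ ⟨j, rfl⟩
    induction j with
    | zero => simpa using incl_mem_saturation e
    | succ j ih =>
      simp only [pow_succ', mul_smul]
      exact tau_smul_mem ih

lemma algebraMap_smul_eq (c : ℂ) (v : LocMod F) :
    algebraMap ℂ Loc c • v = (PowerSeries.C c : PowerSeries ℂ) • v := by
  rw [series_smul_def, ← PowerSeries.algebraMap_eq, AlgHom.commutes]
  rfl

/-- Every element of the saturation is a polynomial in `-b⁻¹a` applied to the generator,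
modulo `b`. -/
lemma exists_aeval_smul_add (hF : IsABModule F) {e : F} (he : Submodule.span ABTilde {e} = ⊤)
    {v : LocMod F} (hv : v ∈ saturation F) : ∃ (P : ℂ[X]), ∃ w ∈ saturation F,
      v = aeval tau P • incl e + (PowerSeries.X : PowerSeries ℂ) • w := by
  have hv' := hv
  rw [saturation_eq_span hF he] at hv'
  induction hv' using Submodule.span_induction with
  | mem x hx =>
    obtain ⟨j, rfl⟩ := hx
    exact ⟨X ^ j, 0, Submodule.zero_mem _, by simp⟩
  | zero => exact ⟨0, 0, Submodule.zero_mem _, by simp⟩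
  | add x y hx' hy' hx hy =>
    rw [← saturation_eq_span hF he] at hx' hy'
    obtain ⟨P, w, hw, h⟩ := hx hx'
    obtain ⟨Q, z, hz, h'⟩ := hy hy'
    exact ⟨P + Q, w + z, Submodule.add_mem _ hw hz, by
      conv_lhs => rw [h, h']
      rw [map_add, add_smul, smul_add]
      abel⟩
  | smul S x hx' hx =>
    rw [← saturation_eq_span hF he] at hx'
    obtain ⟨P, w, hw, h⟩ := hx hx'
    obtain ⟨T, hT⟩ : ∃ T, S = PowerSeries.C (PowerSeries.constantCoeff S) + PowerSeries.X * T :=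
      ⟨_, by rw [add_comm]; exact PowerSeries.eq_X_mul_shift_add_const S⟩
    refine ⟨C (PowerSeries.constantCoeff S) * P,
      PowerSeries.C (PowerSeries.constantCoeff S) • w + T • x,
      Submodule.add_mem _ (Submodule.smul_mem _ _ hw) (Submodule.smul_mem _ _ hx'), ?_⟩
    rw [map_mul, aeval_C, mul_smul, algebraMap_smul_eq]
    conv_lhs => rw [hT, add_smul]
    conv_lhs => enter [1]; rw [h]
    rw [smul_add, smul_add, mul_smul, add_assoc, smul_comm _ (PowerSeries.X : PowerSeries ℂ) w]

end ABModule

/-! ### The filtration of `F^♯` by powers of `b` -/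

namespace ABModule

open ABTilde

section

variable (F : Type*) [AddCommGroup F] [Module ABTilde F]

/-- The submodule `b^n F^♯` of `F[b⁻¹]`. -/
noncomputable def filtration (n : ℕ) : Submodule (PowerSeries ℂ) (LocMod F) :=
  (saturation F).map (LinearMap.lsmul (PowerSeries ℂ) (LocMod F) (PowerSeries.X ^ n))

end

variable {F : Type*} [AddCommGroup F] [Module ABTilde F]

lemma X_pow_smul_mem_filtration {w : LocMod F} (hw : w ∈ saturation F) (n : ℕ) :
    (PowerSeries.X ^ n : PowerSeries ℂ) • w ∈ filtration F n :=
  ⟨w, hw, rfl⟩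

lemma mem_filtration_iff {n : ℕ} {v : LocMod F} :
    v ∈ filtration F n ↔ ∃ w ∈ saturation F, v = (PowerSeries.X ^ n : PowerSeries ℂ) • w :=
  ⟨fun ⟨w, hw, h⟩ => ⟨w, hw, h.symm⟩, fun ⟨w, hw, h⟩ => ⟨w, hw, h.symm⟩⟩

lemma negB_pow_smul (n : ℕ) (v : LocMod F) :
    (negB : Loc) ^ n • v = (PowerSeries.X ^ n : PowerSeries ℂ) • ((-1 : PowerSeries ℂ) ^ n • v) := by
  rw [series_smul_def, toLoc_ofB_X_pow]
  rcases neg_one_pow_eq_or (PowerSeries ℂ) n with h | h <;>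
  rcases Nat.even_or_odd n with h' | h' <;> simp [h'.neg_one_pow]

lemma mem_filtration_iff_negB {n : ℕ} {v : LocMod F} :
    v ∈ filtration F n ↔ ∃ w ∈ saturation F, v = (negB : Loc) ^ n • w := by
  rw [mem_filtration_iff]
  constructor
  · rintro ⟨w, hw, rfl⟩
    refine ⟨(-1 : PowerSeries ℂ) ^ n • w, Submodule.smul_mem _ _ hw, ?_⟩
    rw [negB_pow_smul, smul_smul ((-1) ^ n), ← mul_pow, neg_one_mul, neg_neg, one_pow, one_smul]
  · rintro ⟨w, hw, rfl⟩
    exact ⟨_, Submodule.smul_mem _ _ hw, negB_pow_smul n w⟩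

lemma filtration_zero : filtration F 0 = saturation F := by
  ext v
  simp [mem_filtration_iff]

lemma X_smul_mem_filtration {n : ℕ} {v : LocMod F} (hv : v ∈ filtration F n) :
    (PowerSeries.X : PowerSeries ℂ) • v ∈ filtration F (n + 1) := by
  obtain ⟨w, hw, rfl⟩ := mem_filtration_iff.mp hv
  rw [smul_smul, ← pow_succ']
  exact X_pow_smul_mem_filtration hw _

lemma negB_smul_mem_filtration {n : ℕ} {v : LocMod F} (hv : v ∈ filtration F n) :
    (negB : Loc) • v ∈ filtration F (n + 1) := by
  rw [negB_smul]
  exact Submodule.neg_mem _ (X_smul_mem_filtration hv)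

/-- `τ` commutes with `b` up to a multiple of `b`, so its stability passes from `b^n F^♯` to
`b^(n+1) F^♯`. -/
lemma tau_smul_mem_filtration {n : ℕ} {v : LocMod F} (hv : v ∈ filtration F n) :
    tau • v ∈ filtration F n := by
  induction n generalizing v with
  | zero => rw [filtration_zero] at hv ⊢; exact tau_smul_mem hv
  | succ n ih =>
    obtain ⟨w, hw, rfl⟩ := mem_filtration_iff.mp hv
    have h := X_pow_smul_mem_filtration hw n
    rw [pow_succ', mul_smul, tau_smul_series, PowerSeries.derivative_X, mul_one]
    exact Submodule.sub_mem _ (X_smul_mem_filtration (ih h)) (X_smul_mem_filtration h)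

lemma a_smul_mem_filtration {n : ℕ} {v : LocMod F} (hv : v ∈ filtration F n) :
    toLoc a • v ∈ filtration F (n + 1) := by
  rw [← negB_mul_tau, mul_smul]
  exact negB_smul_mem_filtration (tau_smul_mem_filtration hv)

lemma b_smul_mem_filtration {n : ℕ} {v : LocMod F} (hv : v ∈ filtration F n) :
    toLoc b • v ∈ filtration F (n + 1) := by
  rw [toLoc_b, neg_smul]
  exact Submodule.neg_mem _ (negB_smul_mem_filtration hv)

/-- An element of `Ã` without components of degree less than `n` in `(a,b)` maps `F` into
`b^n F^♯`. -/
lemma smul_incl_mem_filtration {n : ℕ} {x : ABTilde} (hx : ∀ p ν, p + ν < n → coeff x p ν = 0)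
    (v : F) : toLoc x • incl v ∈ filtration F n := by
  induction n generalizing x with
  | zero => rw [filtration_zero, toLoc_smul_incl]; exact incl_mem_saturation _
  | succ n ih =>
    obtain ⟨y, S, h, hy, hS⟩ := exists_eq_a_mul_add x
    rw [h, map_add, add_smul, map_mul, mul_smul]
    refine Submodule.add_mem _ (a_smul_mem_filtration (ih fun p ν hp => ?_)) ?_
    · rw [hy]
      exact hx _ _ (by omega)
    · have : PowerSeries.X ^ (n + 1) ∣ S := by
        rw [PowerSeries.X_pow_dvd_iff]
        intro m hm
        rw [hS]
        exact hx _ _ (by omega)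
      obtain ⟨T, rfl⟩ := this
      rw [← series_smul_def, mul_smul]
      exact X_pow_smul_mem_filtration (Submodule.smul_mem _ _ (incl_mem_saturation v)) _

lemma smul_incl_mem_filtration_of_isInitialForm {x y : ABTilde} {d : ℕ} (h : IsInitialForm x y d)
    {v : F} (hv : x • v = 0) : toLoc y • incl v ∈ filtration F (d + 1) := by
  -- `y - x` has no component of degree at most `d`, and acts on `v` as `y` does.
  have h1 := smul_incl_mem_filtration (n := d + 1) (x := y - x) (fun p ν hp => by
    rw [coeff_sub, h.2.2 p ν (by omega), sub_self]) v
  rwa [map_sub, sub_smul, toLoc_smul_incl x, hv, incl_zero, sub_zero] at h1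

/-! ### The quotient `F^♯ / b F^♯` -/

lemma mem_bSaturation_iff {v : saturation F} :
    v ∈ bSaturation F ↔ (v : LocMod F) ∈ filtration F 1 := by
  rw [mem_filtration_iff, pow_one]
  constructor
  · rintro ⟨w, rfl⟩
    exact ⟨w, w.2, rfl⟩
  · rintro ⟨w, hw, h⟩
    exact ⟨⟨w, hw⟩, Subtype.ext h.symm⟩

variable (F) in
/-- The action of `-b⁻¹a` on `F^♯ / b F^♯`. -/
noncomputable def quotEnd : Module.End ℂ (saturation F ⧸ bSaturation F) :=
  (bSaturation F).mapQ (bSaturation F) (negBInvA F) (bSaturation_le_comap F)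

lemma coe_aeval_negBInvA (P : ℂ[X]) (v : saturation F) :
    (((aeval (negBInvA F) P : Module.End ℂ (saturation F)) v : saturation F) : LocMod F)
      = aeval tau P • (v : LocMod F) := by
  induction P using Polynomial.induction_on' with
  | add p q hp hq => rw [map_add, map_add, LinearMap.add_apply, Submodule.coe_add, hp, hq, add_smul]
  | monomial m c =>
    rw [aeval_monomial, aeval_monomial, Module.algebraMap_end_eq_smul_id, mul_smul,
      algebraMap_smul_eq]
    change (PowerSeries.C c : PowerSeries ℂ) • (((negBInvA F ^ m) v : saturation F) : LocMod F) = _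
    congr 1
    induction m with
    | zero => simp
    | succ m ih =>
      rw [pow_succ', pow_succ', mul_smul, ← ih, Module.End.mul_apply, tau, neg_smul]
      rfl

lemma aeval_quotEnd_mk (P : ℂ[X]) (v : saturation F) :
    (aeval (quotEnd F) P) (Submodule.Quotient.mk v)
      = Submodule.Quotient.mk ((aeval (negBInvA F) P : Module.End ℂ (saturation F)) v) := by
  induction P using Polynomial.induction_on' with
  | add p q hp hq =>
    rw [map_add, map_add, LinearMap.add_apply, hp, hq, LinearMap.add_apply,
      Submodule.Quotient.mk_add]
  | monomial m c =>
    rw [aeval_monomial, aeval_monomial, Module.algebraMap_end_eq_smul_id,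
      Module.algebraMap_end_eq_smul_id]
    simp only [Module.End.mul_apply, LinearMap.smul_apply, LinearMap.id_apply,
      Submodule.Quotient.mk_smul]
    congr 1
    induction m with
    | zero => simp
    | succ m ih =>
      rw [pow_succ', pow_succ', Module.End.mul_apply, Module.End.mul_apply, ih]
      rfl

/-- The class of `e` is a cyclic vector of `F^♯ / b F^♯`. -/
lemma exists_aeval_quotEnd (hF : IsABModule F) {e : F} (he : Submodule.span ABTilde {e} = ⊤)
    (z : saturation F ⧸ bSaturation F) : ∃ P : ℂ[X],
      aeval (quotEnd F) P (Submodule.Quotient.mk ⟨incl e, incl_mem_saturation e⟩) = z := by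
  obtain ⟨v, rfl⟩ := Submodule.Quotient.mk_surjective _ z
  obtain ⟨P, w, hw, h⟩ := exists_aeval_smul_add hF he v.2
  refine ⟨P, ?_⟩
  rw [aeval_quotEnd_mk, eq_comm, Submodule.Quotient.eq, mem_bSaturation_iff,
    AddSubgroupClass.coe_sub, coe_aeval_negBInvA, h, add_sub_cancel_left]
  rw [← filtration_zero] at hw
  exact X_smul_mem_filtration hw

/-- If a homogeneous element `(-b)^q g(-b⁻¹a)` maps the generator into `b^(q+1) F^♯`, then the
Bernstein polynomial divides `g`. -/
lemma bernsteinPolynomial_dvd (hF : IsABModule F) {e : F} (he : Submodule.span ABTilde {e} = ⊤)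
    {x : ABTilde} {q : ℕ} {g : ℂ[X]} (hx : toLoc x = (negB : Loc) ^ q * aeval tau g)
    (h : toLoc x • incl e ∈ filtration F (q + 1)) : bernsteinPolynomial F ∣ g := by
  refine minpoly.dvd ℂ (quotEnd F) (LinearMap.ext fun z => ?_)
  obtain ⟨P, rfl⟩ := exists_aeval_quotEnd hF he z
  -- Polynomials in one endomorphism commute, so it suffices that `g` kills the cyclic vector.
  rw [← Module.End.mul_apply, ← map_mul, mul_comm, map_mul, Module.End.mul_apply]
  suffices aeval (quotEnd F) g (Submodule.Quotient.mk ⟨incl e, incl_mem_saturation e⟩) = 0 by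
    rw [this, map_zero, LinearMap.zero_apply]
  rw [aeval_quotEnd_mk, Submodule.Quotient.mk_eq_zero, mem_bSaturation_iff, coe_aeval_negBInvA]
  obtain ⟨w, hw, h⟩ := mem_filtration_iff_negB.mp h
  rw [hx, mul_smul, pow_succ, mul_smul] at h
  rw [mem_filtration_iff_negB]
  refine ⟨w, hw, ?_⟩
  have := congrArg (fun z => ((((negB ^ q)⁻¹ : Locˣ)) : Loc) • z) h
  rw [← Units.val_pow_eq_pow_val] at this
  simpa only [smul_smul, Units.inv_mul_cancel_left, Units.inv_mul, one_smul, pow_one] using this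

/-! ### The rank -/

/-- Finitely many generators of `F^♯` have a common denominator `b^n`. -/
lemma exists_X_pow_smul_mem_range [Module.Finite (PowerSeries ℂ) (saturation F)] :
    ∃ n : ℕ, ∀ v ∈ saturation F, ∃ x : F, (PowerSeries.X ^ n : PowerSeries ℂ) • v = incl x := by
  let _ := bModule F
  have hfg : (saturation F).FG := Module.Finite.iff_fg.mp inferInstance
  obtain ⟨s, hs⟩ := hfg
  choose n x hx using exists_smul_eq_incl (F := F)
  refine ⟨s.sup n, ?_⟩
  have : saturation F ≤ (LinearMap.range (inclLinear (F := F))).comap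
      (LinearMap.lsmul (PowerSeries ℂ) (LocMod F) (PowerSeries.X ^ s.sup n)) := by
    rw [← hs, Submodule.span_le]
    intro v hv
    obtain ⟨m, hm⟩ := Nat.exists_eq_add_of_le (Finset.le_sup (f := n) hv)
    refine ⟨(PowerSeries.X ^ m : PowerSeries ℂ) • x v, ?_⟩
    rw [map_smul, LinearMap.lsmul_apply, hm, add_comm, pow_add, mul_smul, hx]
    rfl
  intro v hv
  obtain ⟨y, hy⟩ := this hv
  exact ⟨y, hy.symm⟩

/-- `F` embeds in `F^♯`, and multiplication by a common denominator `b^n` embeds `F^♯` back in `F`.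
-/
lemma finrank_saturation (hF : IsABModule F) (hr : IsRegular F) :
    Module.finrank (PowerSeries ℂ) (saturation F) = rank F := by
  let _ := bModule F
  have := hF.1
  have := hF.2
  have hr' : Module.Finite (PowerSeries ℂ) (saturation F) := hr
  have hinj : Function.Injective (inclLinear (F := F)) := incl_injective hF
  apply le_antisymm
  · obtain ⟨n, hn⟩ := exists_X_pow_smul_mem_range (F := F)
    let g : saturation F →ₗ[PowerSeries ℂ] LinearMap.range (inclLinear (F := F)) :=
      LinearMap.codRestrict _ ((LinearMap.lsmul (PowerSeries ℂ) (LocMod F)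
        (PowerSeries.X ^ n)).comp (saturation F).subtype) fun v => by
          obtain ⟨x, hx⟩ := hn v v.2
          exact ⟨x, hx.symm⟩
    have hg : Function.Injective g := by
      intro v w h
      have h' : (PowerSeries.X ^ n : PowerSeries ℂ) • (v : LocMod F)
        = (PowerSeries.X ^ n : PowerSeries ℂ) • (w : LocMod F) := congrArg Subtype.val h
      exact Subtype.ext (smul_right_injective _ (pow_ne_zero n PowerSeries.X_ne_zero) h')
    have h1 := LinearMap.finrank_le_finrank_of_injective hg
    rwa [← (LinearEquiv.ofInjective inclLinear hinj).finrank_eq] at h1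
  · let g : F →ₗ[PowerSeries ℂ] saturation F :=
      LinearMap.codRestrict _ inclLinear incl_mem_saturation
    refine LinearMap.finrank_le_finrank_of_injective (f := g) fun v w h => ?_
    exact hinj (congrArg Subtype.val h)

/-- The quotient `F^♯ / b F^♯` of a regular (a,b)-module. -/
lemma nonempty_quot_linearEquiv (hF : IsABModule F) (hr : IsRegular F) :
    Nonempty ((saturation F ⧸ bSaturation F) ≃ₗ[ℂ] (Fin (rank F) → ℂ)) := by
  have hr' : Module.Finite (PowerSeries ℂ) (saturation F) := hr
  let B := Module.finBasisOfFinrankEq (PowerSeries ℂ) (saturation F) (finrank_saturation hF hr)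
  -- Setting `b = 0` in the coordinates of a `ℂ[[b]]`-basis; the kernel is `b F^♯`.
  let g : saturation F →ₗ[ℂ] (Fin (rank F) → ℂ) :=
    { toFun := fun v i => PowerSeries.constantCoeff (B.equivFun v i)
      map_add' := fun v w => by ext i; simp
      map_smul' := fun c v => by
        ext i
        rw [← algebraMap_smul (PowerSeries ℂ) c v, map_smul]
        simp }
  have hsurj : Function.Surjective g := by
    intro y
    refine ⟨B.equivFun.symm fun i => PowerSeries.C (y i), ?_⟩
    ext i
    change PowerSeries.constantCoeff (B.equivFun (B.equivFun.symm _) i) = y i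
    rw [LinearEquiv.apply_symm_apply, PowerSeries.constantCoeff_C]
  have hker : LinearMap.ker g = bSaturation F := by
    ext v
    constructor
    · intro hv
      have h : ∀ i, PowerSeries.X ∣ B.equivFun v i := fun i =>
        PowerSeries.X_dvd_iff.mpr (congrFun hv i)
      choose y hy using h
      refine ⟨B.equivFun.symm y, B.equivFun.injective ?_⟩
      rw [LinearMap.lsmul_apply, map_smul, LinearEquiv.apply_symm_apply]
      ext1 i
      rw [hy i]
      rfl
    · rintro ⟨w, rfl⟩
      rw [LinearMap.mem_ker]
      ext i
      change PowerSeries.constantCoeff (B.equivFun ((PowerSeries.X : PowerSeries ℂ) • w) i) = 0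
      rw [map_smul]
      simp
  rw [← hker]
  exact ⟨g.quotKerEquivOfSurjective hsurj⟩

lemma bernsteinPolynomial_monic (hF : IsABModule F) (hr : IsRegular F) :
    (bernsteinPolynomial F).Monic := by
  obtain ⟨E⟩ := nonempty_quot_linearEquiv hF hr
  have := Module.Finite.equiv E.symm
  exact minpoly.monic (Algebra.IsIntegral.isIntegral (quotEnd F))

/-- Cayley–Hamilton bounds the degree by the dimension. Conversely, reducing modulo the minimal
polynomial, the polynomials of smaller degree applied to the cyclic vector already fill the
quotient. -/
lemma natDegree_bernsteinPolynomial (hF : IsABModule F) (hr : IsRegular F) {e : F}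
    (he : Submodule.span ABTilde {e} = ⊤) : (bernsteinPolynomial F).natDegree = rank F := by
  obtain ⟨E⟩ := nonempty_quot_linearEquiv hF hr
  have hfin := Module.Finite.equiv E.symm
  have hrank : Module.finrank ℂ (saturation F ⧸ bSaturation F) = rank F := by
    rw [E.finrank_eq, Module.finrank_fin_fun]
  have hm := bernsteinPolynomial_monic hF hr
  rw [← hrank]
  apply le_antisymm
  · rw [← (quotEnd F).charpoly_natDegree]
    exact natDegree_le_of_dvd (quotEnd F).minpoly_dvd_charpoly (quotEnd F).charpoly_monic.ne_zero
  · set d := (bernsteinPolynomial F).natDegree with hd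
    let g : degreeLT ℂ d →ₗ[ℂ] (saturation F ⧸ bSaturation F) :=
      { toFun := fun P => aeval (quotEnd F) (P : ℂ[X])
          (Submodule.Quotient.mk ⟨incl e, incl_mem_saturation e⟩)
        map_add' := fun P Q => by simp
        map_smul' := fun c P => by simp }
    have hfd : Module.Finite ℂ (degreeLT ℂ d) := Module.Finite.equiv (degreeLTEquiv ℂ d).symm
    have hg : Function.Surjective g := by
      intro z
      obtain ⟨P, rfl⟩ := exists_aeval_quotEnd hF he z
      refine ⟨⟨P %ₘ bernsteinPolynomial F, ?_⟩, ?_⟩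
      · rw [mem_degreeLT, hd, ← degree_eq_natDegree hm.ne_zero]
        exact degree_modByMonic_lt _ hm
      · change aeval (quotEnd F) (P %ₘ bernsteinPolynomial F) _ = _
        congr 1
        conv_rhs => rw [← modByMonic_add_div P (bernsteinPolynomial F)]
        rw [map_add, map_mul, show aeval (quotEnd F) (bernsteinPolynomial F) = 0 from
          minpoly.aeval ℂ (quotEnd F), zero_mul, add_zero]
    have h1 := LinearMap.finrank_le_finrank_of_surjective hg
    rwa [(degreeLTEquiv ℂ d).finrank_eq, Module.finrank_fin_fun] at h1

end ABModule

/-! ### Products of linear factors and their twisted forms -/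

namespace ABModule

open ABTilde

/-- `a - cb = (-b)(τ + c)`, and moving `τ + c` past `(-b)^d` turns it into `τ - (d - c)`. -/
lemma toLoc_linear_mul (c : ℂ) (d : ℕ) (g : ℂ[X]) :
    toLoc (a - c • b) * ((negB : Loc) ^ d * aeval tau g)
      = (negB : Loc) ^ (d + 1) * aeval tau ((X - C ((d : ℂ) - c)) * g) := by
  have h : (X - C ((d : ℂ) - c)) * g = (X - C (d : ℂ)) * g + C c * g := by
    rw [map_sub]; ring
  rw [map_sub, sub_mul, toLoc_a_mul, h, map_add, mul_add, toLoc_smul, toLoc_b, mul_neg,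
    neg_mul, sub_neg_eq_add, map_mul _ (C c), aeval_C, pow_succ']
  congr 1
  simp only [mul_assoc, Algebra.left_comm]

lemma linearProd_succ {k : ℕ} (l : Fin (k + 1) → ℂ) :
    linearProd l = (a - l 0 • b) * linearProd fun j => l j.succ := by
  rw [linearProd, List.ofFn_succ, List.prod_cons, linearProd]

lemma twistedProd_succ {k : ℕ} (l : Fin (k + 1) → ℂ) (S : Fin (k + 1) → PowerSeries ℂ) :
    twistedProd l S
      = (a - l 0 • b) * ofB (S 0)⁻¹ * twistedProd (fun j => l j.succ) fun j => S j.succ := by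
  rw [twistedProd, List.ofFn_succ, List.prod_cons, twistedProd]

lemma exists_aeval_linearProd {k : ℕ} (l : Fin k → ℂ) : ∃ f : ℂ[X], f.Monic ∧ f.natDegree = k ∧
    toLoc (linearProd l) = (negB : Loc) ^ k * aeval tau f := by
  induction k with
  | zero => exact ⟨1, monic_one, natDegree_one, by simp [linearProd]⟩
  | succ k ih =>
    obtain ⟨g, hg, hd, h⟩ := ih fun j => l j.succ
    refine ⟨_, (monic_X_sub_C ((k : ℂ) - l 0)).mul hg, ?_, ?_⟩
    · rw [(monic_X_sub_C _).natDegree_mul hg, natDegree_X_sub_C, hd, add_comm]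
    · rw [linearProd_succ, map_mul, h, toLoc_linear_mul]

variable {F : Type*} [AddCommGroup F] [Module ABTilde F]

lemma linear_smul_mem_filtration (c : ℂ) {n : ℕ} {v : LocMod F} (hv : v ∈ filtration F n) :
    toLoc (a - c • b) • v ∈ filtration F (n + 1) := by
  rw [map_sub, sub_smul, toLoc_smul, mul_smul, algebraMap_smul_eq]
  exact Submodule.sub_mem _ (a_smul_mem_filtration hv)
    (Submodule.smul_mem _ _ (b_smul_mem_filtration hv))

lemma linearProd_smul_mem_filtration {k : ℕ} (l : Fin k → ℂ) (v : F) :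
    toLoc (linearProd l) • incl v ∈ filtration F k := by
  induction k with
  | zero =>
    rw [filtration_zero, toLoc_smul_incl]
    exact incl_mem_saturation _
  | succ k ih =>
    rw [linearProd_succ, map_mul, mul_smul]
    exact linear_smul_mem_filtration _ (ih _)

/-- Each `S_j⁻¹` is `1` modulo `b`, so dropping it costs one extra power of `b`, while each linear
factor raises the filtration index by one. -/
lemma twistedProd_sub_linearProd_mem {k : ℕ} (l : Fin k → ℂ) (S : Fin k → PowerSeries ℂ)
    (hS : ∀ j, PowerSeries.constantCoeff (S j) = 1) (v : F) :
    toLoc (twistedProd l S) • incl v - toLoc (linearProd l) • incl v ∈ filtration F (k + 1) := by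
  induction k with
  | zero => simp [twistedProd, linearProd]
  | succ k ih =>
    have h1 := ih (fun j => l j.succ) (fun j => S j.succ) fun j => hS j.succ
    have h2 := linearProd_smul_mem_filtration (fun j => l j.succ) v
    rw [linearProd_succ, twistedProd_succ, map_mul, map_mul, map_mul, mul_smul, mul_smul, mul_smul,
      ← smul_sub, ← series_smul_def]
    apply linear_smul_mem_filtration
    set w := toLoc (linearProd fun j => l j.succ) • incl v
    obtain ⟨T, hT⟩ : PowerSeries.X ∣ (S 0)⁻¹ - 1 := by
      rw [PowerSeries.X_dvd_iff, map_sub, PowerSeries.constantCoeff_inv, hS]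
      simp
    have h3 : (S 0)⁻¹ • w - w = T • (PowerSeries.X : PowerSeries ℂ) • w := by
      rw [smul_smul, mul_comm, ← hT, sub_smul, one_smul]
    have h4 := Submodule.add_mem _ (Submodule.smul_mem _ (S 0)⁻¹ h1)
      (h3 ▸ Submodule.smul_mem _ T (X_smul_mem_filtration h2))
    rwa [smul_sub, sub_add_sub_cancel] at h4

/-- The Bernstein polynomial of a cyclic regular (a,b)-module presented by a twisted product. -/
lemma toLoc_linearProd_eq (hF : IsABModule F) (hr : IsRegular F) {k : ℕ} (hk : rank F = k)
    (l : Fin k → ℂ) (S : Fin k → PowerSeries ℂ)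
    (hS : ∀ j, PowerSeries.constantCoeff (S j) = 1)
    (φ : F ≃ₗ[ABTilde] ABTilde ⧸ Submodule.span ABTilde {twistedProd l S}) :
    toLoc (linearProd l) = (negB : Loc) ^ k * aeval tau (bernsteinPolynomial F) := by
  -- The class of `1` is a generator killed by the twisted product. It need not be a generator given
  -- beforehand, but `B_F` depends only on `F`.
  set e := φ.symm (Submodule.Quotient.mk 1) with hedef
  have he : Submodule.span ABTilde {e} = ⊤ := by
    rw [eq_top_iff]
    intro v _
    obtain ⟨x, hx⟩ := Submodule.Quotient.mk_surjective _ (φ v)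
    refine Submodule.mem_span_singleton.mpr ⟨x, φ.injective ?_⟩
    rw [map_smul, hedef, LinearEquiv.apply_symm_apply, ← Submodule.Quotient.mk_smul, smul_eq_mul,
      mul_one, hx]
  have h0 : twistedProd l S • e = 0 := by
    rw [hedef, ← map_smul, ← Submodule.Quotient.mk_smul, smul_eq_mul, mul_one,
      (Submodule.Quotient.mk_eq_zero _).mpr (Submodule.mem_span_singleton_self _), map_zero]
  obtain ⟨f, hf, hd, h⟩ := exists_aeval_linearProd l
  have h1 := twistedProd_sub_linearProd_mem l S hS e
  rw [toLoc_smul_incl, h0, incl_zero, zero_sub, neg_mem_iff] at h1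
  have h2 := bernsteinPolynomial_dvd hF he h h1
  -- Divisibility between monic polynomials of the same degree `k` is equality.
  rw [h, eq_of_monic_of_dvd_of_natDegree_le (bernsteinPolynomial_monic hF hr) hf h2
    (by rw [hd, natDegree_bernsteinPolynomial hF hr he, hk])]

end ABModule

theorem mainTheorem7 {F : Type*} [AddCommGroup F] [Module ABTilde F]
    (k q : ℕ) (hF : ABModule.IsFresco F) (hk : ABModule.rank F = k)
    (e : F) (he : Submodule.span ABTilde {e} = ⊤)
    (Qfull Q : ABTilde) (hann : Qfull • e = 0)
    (hinit : ABTilde.IsInitialForm Qfull Q q) (hmonic : ABTilde.IsMonicForm Q q) :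
    ∃ PF : ABTilde,
      -- `PF` is the Bernstein element of `F`
      (ABTilde.toLoc PF = ABModule.bernsteinElement F ∧ ABTilde.IsMonicForm PF k ∧
        ∀ (l : Fin k → ℂ) (S : Fin k → PowerSeries ℂ),
          (∀ j, PowerSeries.constantCoeff (S j) = 1) →
          Nonempty (F ≃ₗ[ABTilde]
            ABTilde ⧸ Submodule.span ABTilde {ABModule.twistedProd l S}) →
          PF = ABModule.linearProd l) ∧
      k ≤ q ∧
      ∃ W : ABTilde, ABTilde.IsMonicForm W (q - k) ∧ Q = W * PF ∧
        ∃ BQ C : Polynomial ℂ,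
          (∀ B : Polynomial ℂ,
            Polynomial.aeval (-ABTilde.bInvA) B =
                ((((-ABTilde.bUnit) ^ (-(q : ℤ)) : ABTilde.Locˣ) : ABTilde.Loc) *
                  ABTilde.toLoc Q) ↔ B = BQ) ∧
          (∀ D : Polynomial ℂ,
            Polynomial.aeval (-ABTilde.bInvA) D =
                (((-ABTilde.bUnit) ^ (-(k : ℤ)) : ABTilde.Locˣ) : ABTilde.Loc) *
                  ((((-ABTilde.bUnit) ^ (-((q - k : ℕ) : ℤ)) : ABTilde.Locˣ) : ABTilde.Loc) *
                    ABTilde.toLoc W) *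
                  (((-ABTilde.bUnit) ^ (k : ℤ) : ABTilde.Locˣ) : ABTilde.Loc) ↔ D = C) ∧
          BQ = C * ABModule.bernsteinPolynomial F := by
  open ABTilde ABModule in
  obtain ⟨⟨hAB, hr, -⟩, -⟩ := hF
  set B := bernsteinPolynomial F
  have hBm : B.Monic := bernsteinPolynomial_monic hAB hr
  have hBd : B.natDegree = k := (natDegree_bernsteinPolynomial hAB hr he).trans hk
  obtain ⟨PF, hPFm, hPF⟩ := exists_isMonicForm hBm hBd
  obtain ⟨g, hgm, hgd, hg⟩ := hmonic.exists_aeval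
  obtain ⟨D, hD⟩ := bernsteinPolynomial_dvd hAB he hg
    (smul_incl_mem_filtration_of_isInitialForm hinit hann)
  have hDm : D.Monic := hBm.of_mul_monic_left (hD ▸ hgm)
  have hdeg : k + D.natDegree = q := by rw [← hgd, hD, hBm.natDegree_mul hDm, hBd]
  -- The cofactor `D` is translated by `k` because in `W * PF` it stands to the left of `(-b)^k`;
  -- moving that power across restores `D(τ)`. Hence the conjugate in the statement recovers `C =
  -- D`.
  obtain ⟨W, hWm, hW⟩ := exists_isMonicForm (d := q - k) (hDm.comp_X_add_C (k : ℂ))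
    (by rw [natDegree_comp, natDegree_X_add_C]; omega)
  have hWk : aeval tau (D.comp (X + C (k : ℂ))) * (negB : Loc) ^ k
      = (negB : Loc) ^ k * aeval tau D := by
    rw [aeval_tau_mul_negB_pow, comp_assoc]
    simp
  have hpow : (negB : Loc) ^ q = (negB : Loc) ^ (q - k) * (negB : Loc) ^ k := by
    rw [← pow_add]
    congr 1
    omega
  have hinv : ∀ (n : ℕ) (z : Loc),
      ((negB ^ (-(n : ℤ)) : Locˣ) : Loc) * ((negB : Loc) ^ n * z) = z := by
    intro n z
    rw [zpow_neg, zpow_natCast, ← Units.val_pow_eq_pow_val, Units.inv_mul_cancel_left]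
  refine ⟨PF, ⟨?_, hPFm, fun l S hS ⟨φ⟩ => toLoc_injective ?_⟩, by omega, W, hWm,
    toLoc_injective ?_, g, D, fun P => ?_, fun P => ?_, ?_⟩
  · rw [hPF, bernsteinElement, hk, Units.val_pow_eq_pow_val]
  · rw [hPF, toLoc_linearProd_eq hAB hr hk l S hS φ]
  · rw [map_mul, hg, hW, hPF, hD, mul_comm, map_mul, hpow, mul_assoc, ← mul_assoc _ (aeval tau D),
      ← hWk]
    simp only [mul_assoc]
    rfl
  · rw [hg, hinv]
    exact aeval_tau_injective.eq_iff
  · rw [hW, hinv, zpow_natCast, Units.val_pow_eq_pow_val, mul_assoc, hWk, hinv]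
    exact aeval_tau_injective.eq_iff
  · rw [hD, mul_comm]
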